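/- **Theorem 3.1.** Let $M\ge 1$, let $\Sigma=(\sigma_{ij})$ be a known positive definite $M\times M$ covariance matrix, and let $C_1>C_2>\dots>C_M>0$ be constants. *Statistics.* For a set $E\subsetneq\{1,\dots,M\}$ of eliminated indices and $j\notin E$, let $R=\{1,\dots,M\}\setminus(E\cup\{j\})$, let $\Sigma_R=(\sigma_{kl})_{k,l\in R}$, $\boldsymbol\sigma_{j,R}=(\sigma_{jk})_{k\in R}$, $\mathbf x_R=(x_k)_{k\in R}$, and $$U_{E,j}(\mathbf x)=\frac{x_j-\boldsymbol\sigma_{j,R}'\,\Sigma_R^{-1}\,\mathbf x_R}{\bigl(\sigma_{jj}-\boldsymbol\sigma_{j,R}'\,\Sigma_R^{-1}\,\boldsymbol\sigma_{j,R}\bigr)^{1/2}}$$ (empty products are $0$). *Procedure.* Given statistics $V_{E,j}$, the maximum residual down (MRD) procedure starts with $E=\emptyset$. At stage $m=1,\dots,M$, where $|E|=m-1$, let $j_m\notin E$ maximize $V_{E,j}$ over $j\notin E$, ties being broken in an arbitrary way. If $V_{E,j_m}<C_m$, stop and accept all remaining hypotheses; otherwise reject $H_{j_m}$, add $j_m$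 to $E$, and go to stage $m+1$ (stop if $m=M$). The individual test $\phi_i$ induced by the procedure equals $1$ if $H_i$ is rejected and $0$ otherwise. *Admissibility.* A test $\phi$ (measurable up to null sets, with values in $[0,1]$) of $\theta\in H$ against $\theta\in K$ is admissible if there is no test $\phi'$ with $E_\theta\phi'\le E_\theta\phi$ for all $\theta\in H$ and $E_\theta\phi'\ge E_\theta\phi$ for all $\theta\in K$, with strict inequality for some $\theta\in H\cup K$. The procedure is admissible if, for every $i=1,\dots,M$, $\phi_i$ is an admissible test of the $i$-th hypothesis against its alternative. *Known covariance.* Let $\mathbf X\sim N(\boldsymbol\mu,\Sigma)$ with unknown $\boldsymbol\mu\in\mathbb R^M$. Then: 1. the MRD procedure with $V_{E,j}=|U_{E,j}(\mathbf X)|$ is admissible for $H_i:\mu_i=0$ vs. $K_i:\mu_i\ne0$, $i=1,\dots,M$; 2. the MRD procedure with $V_{E,j}=U_{E,j}(\mathbf X)$ is admissible for $H_i:\mu_i=0$ vs. $K_i^*:\mu_i>0$, $i=1,\dots,M$; 3. the MRD procedure with $V_{E,j}=U_{E,j}(\mathbf X)$ is admissible for $H_i^*:\mu_i\le0$ vs.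 $K_i^*:\mu_i>0$, $i=1,\dots,M$. *Unknown variance factor.* Let $\nu>0$, let $\mathbf X\sim N(\boldsymbol\mu,\sigma^2\Sigma)$ with $\boldsymbol\mu\in\mathbb R^M$ and $\sigma^2>0$ both unknown, and let $s^2$ be independent of $\mathbf X$ with $\nu s^2/\sigma^2\sim\chi^2_\nu$. Tests are functions of $(\mathbf X,s^2)$, the parameter is $(\boldsymbol\mu,\sigma^2)$, and $T=\nu s^2+\mathbf X'\Sigma^{-1}\mathbf X$. Then 1–3 hold with $U_{E,j}(\mathbf X)/T^{1/2}$ in place of $U_{E,j}(\mathbf X)$. -/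

import Mathlib

open MeasureTheory ProbabilityTheory
open scoped Matrix

noncomputable section

namespace MRD

/-! ### Conditional residual statistics -/

/-- The indices that remain after leaving out the eliminated indices `E` and the index `j`. -/
abbrev others {M : ℕ} (E : Finset (Fin M)) (j : Fin M) : Finset (Fin M) := (insert j E)ᶜ

/-- The covariance matrix of the vector of the remaining variables. -/
def subCov {M : ℕ} (S : Matrix (Fin M) (Fin M) ℝ) (E : Finset (Fin M)) (j : Fin M) :
    Matrix {k // k ∈ others E j} {k // k ∈ others E j} ℝ :=
  S.submatrix Subtype.val Subtype.val

/-- The vector of covariances between the `j`-th variable and the remaining variables. -/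
def crossCov {M : ℕ} (S : Matrix (Fin M) (Fin M) ℝ) (E : Finset (Fin M)) (j : Fin M) :
    {k // k ∈ others E j} → ℝ :=
  fun k => S j k.val

/-- The conditional variance of the `j`-th variable given the remaining variables. -/
def condVar {M : ℕ} (S : Matrix (Fin M) (Fin M) ℝ) (E : Finset (Fin M)) (j : Fin M) : ℝ :=
  S j j - crossCov S E j ⬝ᵥ ((subCov S E j)⁻¹ *ᵥ crossCov S E j)

/-- The standardized conditional residual `U` of the `j`-th variable, when the variables with
index in `E` have been eliminated; it belongs to stage `m = E.card + 1`. -/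
def resid {M : ℕ} (S : Matrix (Fin M) (Fin M) ℝ) (E : Finset (Fin M)) (j : Fin M)
    (x : EuclideanSpace ℝ (Fin M)) : ℝ :=
  (x j - crossCov S E j ⬝ᵥ ((subCov S E j)⁻¹ *ᵥ fun k => x k.val)) / √(condVar S E j)

/-- The statistic `T = ν s² + x' S⁻¹ x`, as a function of the data `z = (x, s²)`. -/
def statT {M : ℕ} (S : Matrix (Fin M) (Fin M) ℝ) (ν : ℝ)
    (z : EuclideanSpace ℝ (Fin M) × ℝ) : ℝ :=
  ν * z.2 + (fun k => z.1 k) ⬝ᵥ (S⁻¹ *ᵥ fun k => z.1 k)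

/-- The residual statistic `U / T^(1/2)` for unknown variance factor. -/
def residT {M : ℕ} (S : Matrix (Fin M) (Fin M) ℝ) (ν : ℝ) (E : Finset (Fin M)) (j : Fin M)
    (z : EuclideanSpace ℝ (Fin M) × ℝ) : ℝ :=
  resid S E j z.1 / √(statT S ν z)

/-! ### The step-down procedure -/

/-- `sel x E` is, for every sample point `x` and every proper set `E` of eliminated indices, an
index that maximizes the statistic among the indices that are not eliminated (ties are broken in
an arbitrary way). -/
def IsMaximizer {𝒳 : Type*} {M : ℕ} (stat : Finset (Fin M) → Fin M → 𝒳 → ℝ)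
    (sel : 𝒳 → Finset (Fin M) → Fin M) : Prop :=
  ∀ (x : 𝒳) (E : Finset (Fin M)), E ≠ Finset.univ →
    sel x E ∉ E ∧ ∀ k, k ∉ E → stat E k x ≤ stat E (sel x E) x

/-- One stage: if `m - 1 = E.card` hypotheses have been rejected, reject the selected hypothesis
when its statistic is at least the `m`-th critical constant; otherwise change nothing. (If the
procedure stops at some stage, all later applications of `step` change nothing either.)
The constant `C_m` is `C ⟨m - 1, _⟩`. -/
def step {𝒳 : Type*} {M : ℕ} (stat : Finset (Fin M) → Fin M → 𝒳 → ℝ)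
    (sel : 𝒳 → Finset (Fin M) → Fin M) (C : Fin M → ℝ) (x : 𝒳) (E : Finset (Fin M)) :
    Finset (Fin M) :=
  open Classical in
  if h : E.card < M then
    if C ⟨E.card, h⟩ ≤ stat E (sel x E) x then insert (sel x E) E else E
  else E

/-- The set of rejected hypotheses: start with no rejection and run `M` stages. -/
def rejected {𝒳 : Type*} {M : ℕ} (stat : Finset (Fin M) → Fin M → 𝒳 → ℝ)
    (sel : 𝒳 → Finset (Fin M) → Fin M) (C : Fin M → ℝ) (x : 𝒳) : Finset (Fin M) :=
  (step stat sel C x)^[M] ∅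

/-! ### Tests and admissibility -/

/-- A (randomized) test: a measurable critical function with values in `[0, 1]`. Measurability up
to null sets of the laws of the model suffices. -/
def IsTest {𝒳 Θ : Type*} [MeasurableSpace 𝒳] (P : Θ → Measure 𝒳) (φ : 𝒳 → ℝ) : Prop :=
  (∀ θ, AEMeasurable φ (P θ)) ∧ ∀ x, 0 ≤ φ x ∧ φ x ≤ 1

/-- `φ'` is better than `φ` for testing `θ ∈ H` against `θ ∈ K`: nowhere a larger probability of
an error of the first or second kind, and somewhere a smaller one. -/
def IsBetter {𝒳 Θ : Type*} [MeasurableSpace 𝒳] (P : Θ → Measure 𝒳) (H K : Set Θ)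
    (φ' φ : 𝒳 → ℝ) : Prop :=
  (∀ θ ∈ H, ∫ x, φ' x ∂P θ ≤ ∫ x, φ x ∂P θ) ∧
  (∀ θ ∈ K, ∫ x, φ x ∂P θ ≤ ∫ x, φ' x ∂P θ) ∧
  ((∃ θ ∈ H, ∫ x, φ' x ∂P θ < ∫ x, φ x ∂P θ) ∨ ∃ θ ∈ K, ∫ x, φ x ∂P θ < ∫ x, φ' x ∂P θ)

/-- Admissibility of a test of `θ ∈ H` against `θ ∈ K`, among all tests. -/
def IsAdmissibleTest {𝒳 Θ : Type*} [MeasurableSpace 𝒳] (P : Θ → Measure 𝒳) (H K : Set Θ)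
    (φ : 𝒳 → ℝ) : Prop :=
  IsTest P φ ∧ ¬ ∃ φ' : 𝒳 → ℝ, IsTest P φ' ∧ IsBetter P H K φ' φ

/-- The individual test of the `i`-th hypothesis that is induced by a multiple testing procedure
with set of rejected hypotheses `R x`. -/
def individualTest {𝒳 : Type*} {M : ℕ} (R : 𝒳 → Finset (Fin M)) (i : Fin M) (x : 𝒳) : ℝ :=
  open Classical in if i ∈ R x then 1 else 0

/-- A multiple testing procedure is admissible if every individual test is admissible. -/
def IsAdmissibleProcedure {𝒳 Θ : Type*} [MeasurableSpace 𝒳] {M : ℕ} (P : Θ → Measure 𝒳)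
    (H K : Fin M → Set Θ) (R : 𝒳 → Finset (Fin M)) : Prop :=
  ∀ i, IsAdmissibleTest P (H i) (K i) (individualTest R i)

/-- The procedure that is based on the statistics `stat` and the critical constants `C` is
admissible, however ties between maximal statistics are broken. -/
def StepDownAdmissible {𝒳 Θ : Type*} [MeasurableSpace 𝒳] {M : ℕ} (P : Θ → Measure 𝒳)
    (H K : Fin M → Set Θ) (stat : Finset (Fin M) → Fin M → 𝒳 → ℝ) (C : Fin M → ℝ) : Prop :=
  ∀ sel, IsMaximizer stat sel → IsAdmissibleProcedure P H K (rejected stat sel C)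

/-! ### The two normal models -/

/-- Known covariance matrix: `X ∼ N(μ, S)`, with parameter `μ`. -/
def knownModel {M : ℕ} (S : Matrix (Fin M) (Fin M) ℝ) (μ : EuclideanSpace ℝ (Fin M)) :
    Measure (EuclideanSpace ℝ (Fin M)) :=
  multivariateGaussian μ S

/-- The chi-square distribution with `ν` degrees of freedom. -/
def chiSquare (ν : ℝ) : Measure ℝ := gammaMeasure (ν / 2) (1 / 2)

/-- Unknown variance factor: `X ∼ N(μ, σ² S)` and, independently, `ν s² / σ²` is chi-square with
`ν` degrees of freedom; the data are `(X, s²)` and the parameter is `(μ, σ²)` with `0 < σ²`. -/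
def unknownModel {M : ℕ} (S : Matrix (Fin M) (Fin M) ℝ) (ν : ℝ)
    (θ : EuclideanSpace ℝ (Fin M) × Set.Ioi (0 : ℝ)) :
    Measure (EuclideanSpace ℝ (Fin M) × ℝ) :=
  (multivariateGaussian θ.1 ((θ.2 : ℝ) • S)).prod
    ((chiSquare ν).map fun w => (θ.2 : ℝ) * w / ν)

end MRD

end

/-!
Each individual problem concerns one natural parameter of an exponential family, the others being
nuisance parameters. With `Y = S⁻¹ x`, the density of `N(μ, S)` relative to `N(0, S)` is
proportional to `exp (μ · Y)`, so for the `i`-th problem `Z = Y i` is the statistic of interest and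
the other coordinates of `Y` form the nuisance statistic `T`. If the variance factor is unknown,
`T` also contains `ν s² + x' S⁻¹ x`, whose natural parameter is `-1 / (2 σ²)`.

*Geometry.* Fixing `T` means moving the data along the `i`-th column of `S`. As long as `i` has not
been eliminated, this changes no conditional residual except the `i`-th one, which increases with
`Z` (`resid_eq_of_nuisStat_eq`, `resid_le_of_nuisStat_eq`). Hence, until `H_i` is rejected, the
procedure sees the same competing statistics on the whole line, and the points at which `H_i` is
accepted form an interval, or a half-line in the one-sided case (`notMem_rejected_of_sections`).
Ties have probability zero, so the tie-breaking rule does not matter.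

*Statistics.* A test whose acceptance region has such sections is admissible (the argument behind
the theorem of Matthes and Truax). Let `h` be the difference between a better test and the given
one. The difference of the power functions vanishes on the boundary of the null hypothesis, and in
the two-sided case so does its derivative, since it has a minimum there. Completeness of the family
of laws of `T` (`setIntegral_preimage_eq_zero`) turns this into `∫ h = 0` and `∫ h Z = 0`
conditionally on `T`. But `h` is nonnegative on the section of the acceptance region and
nonpositive off it. Comparison of `exp (a Z)` with the constant or the secant line that agrees with
it at the end points of the section then makes the power difference against a single alternative
negative, unless `h = 0` (`integral_mul_exp_nonpos_of_isLowerSet`,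
`integral_mul_exp_nonpos_of_ordConnected`). So `h = 0` almost everywhere, and the other test is not
better after all (`IsLocalExpFamily.ae_eq_zero`).
-/

open MeasureTheory ProbabilityTheory
open scoped Matrix

noncomputable section

namespace MRD

/-! ### One-dimensional comparison lemmas -/

lemma ae_eq_zero_of_integral_eq_zero_of_sign {α : Type*} [MeasurableSpace α] {ν : Measure α}
    {f : α → ℝ} (hf : Integrable f ν) (hs : (∀ᵐ y ∂ν, 0 ≤ f y) ∨ ∀ᵐ y ∂ν, f y ≤ 0)
    (h0 : ∫ y, f y ∂ν = 0) : ∀ᵐ y ∂ν, f y = 0 := by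
  rcases hs with hs | hs
  · exact (integral_eq_zero_iff_of_nonneg_ae hs hf).1 h0
  · have h1 : ∫ y, -f y ∂ν = 0 := by rw [integral_neg, h0, neg_zero]
    have h2 : 0 ≤ᵐ[ν] fun y => -f y := by
      filter_upwards [hs] with y hy
      simpa using hy
    filter_upwards [(integral_eq_zero_iff_of_nonneg_ae h2 hf.neg).1 h1] with y hy
    simpa using hy

/-- A function that is concentrated on one point has a constant sign, so it vanishes almost
everywhere if its integral does. -/
lemma ae_eq_zero_of_ae_eq_zero_off_point {ν : Measure ℝ} {h : ℝ → ℝ} (hi : Integrable h ν)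
    (h0 : ∫ y, h y ∂ν = 0) {b : ℝ} (hb : ∀ᵐ y ∂ν, y ≠ b → h y = 0) : ∀ᵐ y ∂ν, h y = 0 := by
  refine ae_eq_zero_of_integral_eq_zero_of_sign hi ?_ h0
  rcases le_total 0 (h b) with hb0 | hb0
  · left
    filter_upwards [hb] with y hy
    by_cases hyb : y = b
    · rwa [hyb]
    · rw [hy hyb]
  · right
    filter_upwards [hb] with y hy
    by_cases hyb : y = b
    · rwa [hyb]
    · rw [hy hyb]

/-- If `h` is nonnegative on a lower set and nonpositive off it, and integrates to zero, then an
increasing exponential weight makes the integral nonpositive (the conditional form of the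
Neyman–Pearson lemma), and strictly negative unless `h` vanishes. -/
lemma integral_mul_exp_nonpos_of_isLowerSet {ν : Measure ℝ} {h : ℝ → ℝ} {A : Set ℝ}
    (hA : IsLowerSet A) (hpos : ∀ᵐ y ∂ν, y ∈ A → 0 ≤ h y) (hneg : ∀ᵐ y ∂ν, y ∉ A → h y ≤ 0)
    (hi : Integrable h ν) (h0 : ∫ y, h y ∂ν = 0) {a : ℝ} (ha : 0 < a)
    (hie : Integrable (fun y => h y * Real.exp (a * y)) ν) :
    ∫ y, h y * Real.exp (a * y) ∂ν ≤ 0 ∧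
      (∫ y, h y * Real.exp (a * y) ∂ν = 0 → ∀ᵐ y ∂ν, h y = 0) := by
  -- once `h` is known to vanish, both claims are immediate
  have fin : (∀ᵐ y ∂ν, h y = 0) → ∫ y, h y * Real.exp (a * y) ∂ν ≤ 0 ∧
      (∫ y, h y * Real.exp (a * y) ∂ν = 0 → ∀ᵐ y ∂ν, h y = 0) := by
    intro hz
    refine ⟨le_of_eq ?_, fun _ => hz⟩
    refine integral_eq_zero_of_ae ?_
    filter_upwards [hz] with y hy
    simp [hy]
  by_cases hne : A.Nonempty
  swap
  · refine fin (ae_eq_zero_of_integral_eq_zero_of_sign hi (Or.inr ?_) h0)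
    filter_upwards [hneg] with y hy
    exact hy fun hyA => hne ⟨y, hyA⟩
  by_cases hbd : BddAbove A
  swap
  · refine fin (ae_eq_zero_of_integral_eq_zero_of_sign hi (Or.inl ?_) h0)
    filter_upwards [hpos] with y hy
    obtain ⟨z, hz, hyz⟩ := not_bddAbove_iff.1 hbd y
    exact hy (hA hyz.le hz)
  set b := sSup A with hb
  have hsub : Integrable (fun y => h y * (Real.exp (a * y) - Real.exp (a * b))) ν := by
    simp_rw [mul_sub]
    exact hie.sub (hi.mul_const _)
  have hint : ∫ y, h y * (Real.exp (a * y) - Real.exp (a * b)) ∂ν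
      = ∫ y, h y * Real.exp (a * y) ∂ν := by
    simp_rw [mul_sub]
    rw [integral_sub hie (hi.mul_const _), integral_mul_const, h0]
    ring
  have hle : ∀ᵐ y ∂ν, h y * (Real.exp (a * y) - Real.exp (a * b)) ≤ 0 := by
    filter_upwards [hpos, hneg] with y hp hn
    rcases lt_trichotomy y b with hyb | hyb | hyb
    · obtain ⟨z, hz, hyz⟩ := exists_lt_of_lt_csSup hne hyb
      refine mul_nonpos_of_nonneg_of_nonpos (hp (hA hyz.le hz)) ?_
      have : Real.exp (a * y) ≤ Real.exp (a * b) := Real.exp_le_exp.2 (by nlinarith)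
      linarith
    · simp [hyb]
    · refine mul_nonpos_of_nonpos_of_nonneg (hn fun hyA => ?_) ?_
      · exact absurd (le_csSup hbd hyA) (not_le.2 hyb)
      · have : Real.exp (a * b) ≤ Real.exp (a * y) := Real.exp_le_exp.2 (by nlinarith)
        linarith
  rw [← hint]
  refine ⟨integral_nonpos_of_ae hle, fun hz => ?_⟩
  refine ae_eq_zero_of_ae_eq_zero_off_point hi h0 (b := b) ?_
  filter_upwards [ae_eq_zero_of_integral_eq_zero_of_sign hsub (Or.inr hle) hz] with y hy hyb
  rcases mul_eq_zero.1 hy with h1 | h1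
  · exact h1
  · exact absurd (mul_left_cancel₀ ha.ne' (Real.exp_injective (sub_eq_zero.1 h1))) hyb

/-- The secant of `y ↦ exp (a y)` through two points, or the tangent if the points coincide. -/
lemma exists_secant_exp {a : ℝ} (ha : 0 < a) {p q : ℝ} (hpq : p ≤ q) :
    ∃ α β : ℝ, ∀ y, (p < y → y < q → Real.exp (a * y) < α + β * y) ∧
      ((y < p ∨ q < y) → α + β * y < Real.exp (a * y)) ∧
      ((y = p ∨ y = q) → α + β * y = Real.exp (a * y)) := by
  rcases hpq.eq_or_lt with rfl | hlt
  · refine ⟨Real.exp (a * p) * (1 - a * p), Real.exp (a * p) * a, fun y =>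
      ⟨fun h1 h2 => ?_, fun h => ?_, fun h => ?_⟩⟩
    · exact absurd (h1.trans h2) (lt_irrefl _)
    · have hyp : y ≠ p := by
        rcases h with h | h
        exacts [h.ne, h.ne']
      have hne : a * (y - p) ≠ 0 := mul_ne_zero ha.ne' (sub_ne_zero.2 hyp)
      have h1 := Real.add_one_lt_exp hne
      have h2 : Real.exp (a * y) = Real.exp (a * p) * Real.exp (a * (y - p)) := by
        rw [← Real.exp_add]; ring_nf
      rw [h2]
      nlinarith [Real.exp_pos (a * p)]
    · rw [or_self] at h
      subst h
      ring
  · have key : ∀ x y z : ℝ, x < y → y < z →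
        (Real.exp (a * y) - Real.exp (a * x)) * (z - y) <
          (Real.exp (a * z) - Real.exp (a * y)) * (y - x) := by
      intro x y z hxy hyz
      have hs := strictConvexOn_exp.slope_strict_mono_adjacent (Set.mem_univ (a * x))
        (Set.mem_univ (a * z)) (mul_lt_mul_of_pos_left hxy ha) (mul_lt_mul_of_pos_left hyz ha)
      rw [← mul_sub, ← mul_sub, div_lt_div_iff₀ (mul_pos ha (sub_pos.2 hxy))
        (mul_pos ha (sub_pos.2 hyz))] at hs
      nlinarith
    have hd : 0 < q - p := sub_pos.2 hlt
    set s := (Real.exp (a * q) - Real.exp (a * p)) / (q - p) with hs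
    have hs' : s * (q - p) = Real.exp (a * q) - Real.exp (a * p) := by rw [hs]; field_simp
    refine ⟨Real.exp (a * p) - s * p, s, fun y =>
      ⟨fun h1 h2 => ?_, fun h => ?_, fun h => ?_⟩⟩
    · have := key p y q h1 h2
      by_contra hcon
      push Not at hcon
      have h3 : s * (y - p) * (q - p) ≤ (Real.exp (a * y) - Real.exp (a * p)) * (q - p) :=
        mul_le_mul_of_nonneg_right (by linarith) hd.le
      nlinarith
    · by_contra hcon
      push Not at hcon
      have h3 : (Real.exp (a * y) - Real.exp (a * p)) * (q - p) ≤ s * (y - p) * (q - p) :=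
        mul_le_mul_of_nonneg_right (by linarith) hd.le
      rcases h with h | h
      · have := key y p q h hlt
        nlinarith
      · have := key p q y hlt h
        nlinarith
    · rcases h with rfl | rfl
      · ring
      · linarith

/-- The conditional form of the generalized Neyman–Pearson lemma: if `h` is nonnegative on an
interval and nonpositive off it, and is orthogonal to all affine functions, then an exponential
weight makes the integral nonpositive, and strictly negative unless `h` vanishes. -/
lemma integral_mul_exp_nonpos_of_ordConnected {ν : Measure ℝ} {h : ℝ → ℝ} {A : Set ℝ}
    (hA : A.OrdConnected) (hpos : ∀ᵐ y ∂ν, y ∈ A → 0 ≤ h y) (hneg : ∀ᵐ y ∂ν, y ∉ A → h y ≤ 0)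
    (hi : Integrable h ν) (h0 : ∫ y, h y ∂ν = 0)
    (hi1 : Integrable (fun y => h y * y) ν) (h1 : ∫ y, h y * y ∂ν = 0) {a : ℝ} (ha : 0 < a)
    (hie : Integrable (fun y => h y * Real.exp (a * y)) ν) :
    ∫ y, h y * Real.exp (a * y) ∂ν ≤ 0 ∧
      (∫ y, h y * Real.exp (a * y) ∂ν = 0 → ∀ᵐ y ∂ν, h y = 0) := by
  have fin : (∀ᵐ y ∂ν, h y = 0) → ∫ y, h y * Real.exp (a * y) ∂ν ≤ 0 ∧
      (∫ y, h y * Real.exp (a * y) ∂ν = 0 → ∀ᵐ y ∂ν, h y = 0) := by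
    intro hz
    refine ⟨le_of_eq ?_, fun _ => hz⟩
    refine integral_eq_zero_of_ae ?_
    filter_upwards [hz] with y hy
    simp [hy]
  have hlin : ∀ p : ℝ, Integrable (fun y => h y * (y - p)) ν ∧ ∫ y, h y * (y - p) ∂ν = 0 := by
    intro p
    simp_rw [mul_sub]
    refine ⟨hi1.sub (hi.mul_const _), ?_⟩
    rw [integral_sub hi1 (hi.mul_const _), integral_mul_const, h0, h1]
    ring
  -- a constant sign of `h y * (y - p)` forces `h` to vanish
  have linear : ∀ p : ℝ, ((∀ᵐ y ∂ν, 0 ≤ h y * (y - p)) ∨ ∀ᵐ y ∂ν, h y * (y - p) ≤ 0) →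
      ∀ᵐ y ∂ν, h y = 0 := by
    intro p hs
    refine ae_eq_zero_of_ae_eq_zero_off_point hi h0 (b := p) ?_
    filter_upwards [ae_eq_zero_of_integral_eq_zero_of_sign (hlin p).1 hs (hlin p).2] with y hy hyp
    exact (mul_eq_zero.1 hy).resolve_right (sub_ne_zero.2 hyp)
  by_cases hne : A.Nonempty
  swap
  · refine fin (ae_eq_zero_of_integral_eq_zero_of_sign hi (Or.inr ?_) h0)
    filter_upwards [hneg] with y hy
    exact hy fun hyA => hne ⟨y, hyA⟩
  by_cases hba : BddAbove A <;> by_cases hbb : BddBelow A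
  · set p := sInf A
    set q := sSup A
    have hpq : p ≤ q := csInf_le_csSup hne hbb hba
    obtain ⟨α, β, hαβ⟩ := exists_secant_exp ha hpq
    have hia : Integrable (fun y => h y * (α + β * y)) ν := by
      have : (fun y => h y * (α + β * y)) = fun y => h y * α + h y * y * β := by
        ext y; ring
      rw [this]
      exact (hi.mul_const _).add (hi1.mul_const _)
    have hia0 : ∫ y, h y * (α + β * y) ∂ν = 0 := by
      have : (fun y => h y * (α + β * y)) = fun y => h y * α + h y * y * β := by
        ext y; ring
      rw [this, integral_add (hi.mul_const _) (hi1.mul_const _), integral_mul_const,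
        integral_mul_const, h0, h1]
      ring
    have hsub : Integrable (fun y => h y * (Real.exp (a * y) - (α + β * y))) ν := by
      simp_rw [mul_sub]
      exact hie.sub hia
    have hint : ∫ y, h y * (Real.exp (a * y) - (α + β * y)) ∂ν
        = ∫ y, h y * Real.exp (a * y) ∂ν := by
      simp_rw [mul_sub]
      rw [integral_sub hie hia, hia0, sub_zero]
    have hin : ∀ y, p < y → y < q → y ∈ A := by
      intro y hy1 hy2
      obtain ⟨z, hz, hzy⟩ := exists_lt_of_csInf_lt hne hy1
      obtain ⟨w, hw, hyw⟩ := exists_lt_of_lt_csSup hne hy2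
      exact hA.out hz hw ⟨hzy.le, hyw.le⟩
    have hout : ∀ y, y < p ∨ q < y → y ∉ A := by
      rintro y (hy | hy) hyA
      · exact absurd (csInf_le hbb hyA) (not_le.2 hy)
      · exact absurd (le_csSup hba hyA) (not_le.2 hy)
    have hle : ∀ᵐ y ∂ν, h y * (Real.exp (a * y) - (α + β * y)) ≤ 0 := by
      filter_upwards [hpos, hneg] with y hp hn
      by_cases hy : p < y ∧ y < q
      · have := (hαβ y).1 hy.1 hy.2
        exact mul_nonpos_of_nonneg_of_nonpos (hp (hin y hy.1 hy.2)) (by linarith)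
      by_cases hy' : y < p ∨ q < y
      · have := (hαβ y).2.1 hy'
        exact mul_nonpos_of_nonpos_of_nonneg (hn (hout y hy')) (by linarith)
      · have := (hαβ y).2.2 (by grind)
        rw [this, sub_self, mul_zero]
    rw [← hint]
    refine ⟨integral_nonpos_of_ae hle, fun hz => ?_⟩
    -- `h` can only live on the two end points, where a linear weight finishes the argument
    have hend : ∀ᵐ y ∂ν, y ≠ p → y ≠ q → h y = 0 := by
      filter_upwards [ae_eq_zero_of_integral_eq_zero_of_sign hsub (Or.inr hle) hz] with y hy hyp hyq
      refine (mul_eq_zero.1 hy).resolve_right fun h2 => ?_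
      by_cases hy1 : p < y ∧ y < q
      · have := (hαβ y).1 hy1.1 hy1.2
        linarith
      · have := (hαβ y).2.1 (by grind)
        linarith
    refine linear p ?_
    rcases le_total 0 (h q * (q - p)) with hq | hq
    · left
      filter_upwards [hend] with y hy
      by_cases hyp : y = p
      · simp [hyp]
      by_cases hyq : y = q
      · rwa [hyq]
      · simp [hy hyp hyq]
    · right
      filter_upwards [hend] with y hy
      by_cases hyp : y = p
      · simp [hyp]
      by_cases hyq : y = q
      · rwa [hyq]
      · simp [hy hyp hyq]
  · refine fin (linear (sSup A) (Or.inr ?_))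
    filter_upwards [hpos, hneg] with y hp hn
    rcases lt_trichotomy y (sSup A) with hy | hy | hy
    · obtain ⟨w, hw, hyw⟩ := exists_lt_of_lt_csSup hne hy
      obtain ⟨z, hz, hzy⟩ := not_bddBelow_iff.1 hbb y
      exact mul_nonpos_of_nonneg_of_nonpos (hp (hA.out hz hw ⟨hzy.le, hyw.le⟩)) (by linarith)
    · simp [hy]
    · exact mul_nonpos_of_nonpos_of_nonneg
        (hn fun hyA => absurd (le_csSup hba hyA) (not_le.2 hy)) (by linarith)
  · refine fin (linear (sInf A) (Or.inl ?_))
    filter_upwards [hpos, hneg] with y hp hn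
    rcases lt_trichotomy y (sInf A) with hy | hy | hy
    · exact mul_nonneg_of_nonpos_of_nonpos
        (hn fun hyA => absurd (csInf_le hbb hyA) (not_le.2 hy)) (by linarith)
    · simp [hy]
    · obtain ⟨w, hw, hyw⟩ := exists_lt_of_csInf_lt hne hy
      obtain ⟨z, hz, hzy⟩ := not_bddAbove_iff.1 hba y
      exact mul_nonneg (hp (hA.out hw hz ⟨hyw.le, hzy.le⟩)) (by linarith)
  · refine fin (ae_eq_zero_of_integral_eq_zero_of_sign hi (Or.inl ?_) h0)
    filter_upwards [hpos] with y hp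
    obtain ⟨w, hw, hyw⟩ := not_bddBelow_iff.1 hbb y
    obtain ⟨z, hz, hzy⟩ := not_bddAbove_iff.1 hba y
    exact hp (hA.out hw hz ⟨hyw.le, hzy.le⟩)

/-! ### Laplace transforms of signed densities and completeness -/

section Signed

variable {𝒳 : Type*} [MeasurableSpace 𝒳] {P : Measure 𝒳}

/-- The measure whose density is the positive part of `f`. -/
def posPart (P : Measure 𝒳) (f : 𝒳 → ℝ) : Measure 𝒳 := P.withDensity fun x => ENNReal.ofReal (f x)

lemma isFiniteMeasure_posPart {f : 𝒳 → ℝ} (hf : Integrable f P) :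
    IsFiniteMeasure (posPart P f) :=
  isFiniteMeasure_withDensity_ofReal hf.2

lemma integral_posPart {f : 𝒳 → ℝ} (hf : Integrable f P) (g : 𝒳 → ℝ) :
    ∫ x, g x ∂(posPart P f) = ∫ x, max (f x) 0 * g x ∂P := by
  rw [posPart, integral_withDensity_eq_integral_toReal_smul₀ hf.1.aemeasurable.ennreal_ofReal
    (ae_of_all _ fun x => ENNReal.ofReal_lt_top)]
  simp [ENNReal.toReal_ofReal']

lemma integrable_posPart_iff {f : 𝒳 → ℝ} (hf : Integrable f P) {g : 𝒳 → ℝ} :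
    Integrable g (posPart P f) ↔ Integrable (fun x => max (f x) 0 * g x) P := by
  rw [posPart, integrable_withDensity_iff_integrable_smul₀' hf.1.aemeasurable.ennreal_ofReal
    (ae_of_all _ fun x => ENNReal.ofReal_lt_top)]
  simp [ENNReal.toReal_ofReal']

lemma integrable_posPart {f : 𝒳 → ℝ} (hf : Integrable f P) {g : 𝒳 → ℝ}
    (hg : Measurable g) (hfg : Integrable (fun x => f x * g x) P) :
    Integrable g (posPart P f) := by
  rw [integrable_posPart_iff hf]
  refine hfg.mono ((hf.1.sup aestronglyMeasurable_const).mul hg.aestronglyMeasurable) ?_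
  refine ae_of_all _ fun x => ?_
  simp only [norm_mul, Real.norm_eq_abs]
  refine mul_le_mul_of_nonneg_right ?_ (abs_nonneg _)
  rw [abs_of_nonneg (le_max_right _ _)]
  exact max_le (le_abs_self _) (abs_nonneg _)

lemma integral_posPart_sub {f : 𝒳 → ℝ} (hf : Integrable f P) {g : 𝒳 → ℝ}
    (hg : Measurable g) (hfg : Integrable (fun x => f x * g x) P) :
    ∫ x, g x ∂(posPart P f) - ∫ x, g x ∂(posPart P (-f)) = ∫ x, f x * g x ∂P := by
  have h1 := (integrable_posPart_iff hf).1 (integrable_posPart hf hg hfg)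
  have h2 := (integrable_posPart_iff hf.neg).1 (integrable_posPart hf.neg hg
    (by simpa using hfg.neg))
  rw [integral_posPart hf, integral_posPart hf.neg, ← integral_sub h1 h2]
  refine integral_congr_ae (ae_of_all _ fun x => ?_)
  simp only [Pi.neg_apply]
  rcases le_total 0 (f x) with h | h
  · rw [max_eq_left h, max_eq_right (by linarith)]; ring
  · rw [max_eq_right h, max_eq_left (by linarith)]; ring

lemma integrable_mul_of_posPart {f : 𝒳 → ℝ} (hf : Integrable f P) {g : 𝒳 → ℝ}
    (h1 : Integrable g (posPart P f)) (h2 : Integrable g (posPart P (-f))) :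
    Integrable (fun x => f x * g x) P := by
  refine (((integrable_posPart_iff hf).1 h1).sub ((integrable_posPart_iff hf.neg).1 h2)).congr
    (ae_of_all _ fun x => ?_)
  simp only [Pi.sub_apply, Pi.neg_apply]
  rcases le_total 0 (f x) with h | h
  · rw [max_eq_left h, max_eq_right (by linarith)]; ring
  · rw [max_eq_right h, max_eq_left (by linarith)]; ring

lemma ball_subset_interior_integrableExpSet {X : 𝒳 → ℝ} {μ : Measure 𝒳} {δ : ℝ}
    (h : ∀ t, |t| < δ → Integrable (fun x => Real.exp (t * X x)) μ) :
    Metric.ball (0 : ℝ) δ ⊆ interior (integrableExpSet X μ) := by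
  refine interior_maximal (fun t ht => ?_) Metric.isOpen_ball
  exact h t (by simpa using ht)

/-- Differentiation at the origin of a signed Laplace transform. -/
lemma hasDerivAt_integral_mul_exp {f X : 𝒳 → ℝ} (hf : Integrable f P) (hX : Measurable X)
    {δ : ℝ} (hδ : 0 < δ) (h : ∀ t, |t| < δ → Integrable (fun x => f x * Real.exp (t * X x)) P) :
    Integrable (fun x => f x * X x) P ∧
      HasDerivAt (fun t => ∫ x, f x * Real.exp (t * X x) ∂P) (∫ x, f x * X x ∂P) 0 := by
  have h' : ∀ t, |t| < δ → Integrable (fun x => (-f) x * Real.exp (t * X x)) P := by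
    intro t ht
    simpa using (h t ht).neg
  have hm : ∀ t, Measurable fun x => Real.exp (t * X x) := fun t => by fun_prop
  have hp := ball_subset_interior_integrableExpSet (X := X) (μ := posPart P f)
    fun t ht => integrable_posPart hf (hm t) (h t ht)
  have hn := ball_subset_interior_integrableExpSet (X := X) (μ := posPart P (-f))
    fun t ht => integrable_posPart hf.neg (hm t) (h' t ht)
  have h0 : (0 : ℝ) ∈ Metric.ball (0 : ℝ) δ := Metric.mem_ball_self hδ
  have hXp : Integrable X (posPart P f) := by
    simpa using integrable_pow_of_mem_interior_integrableExpSet (hp h0) 1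
  have hXn : Integrable X (posPart P (-f)) := by
    simpa using integrable_pow_of_mem_interior_integrableExpSet (hn h0) 1
  have hfX := integrable_mul_of_posPart hf hXp hXn
  refine ⟨hfX, ?_⟩
  have hd := (hasDerivAt_mgf (hp h0)).sub (hasDerivAt_mgf (hn h0))
  simp only [zero_mul, Real.exp_zero, mul_one] at hd
  rw [integral_posPart_sub hf hX hfX] at hd
  refine hd.congr_of_eventuallyEq ?_
  filter_upwards [Metric.ball_mem_nhds (0 : ℝ) hδ] with t ht
  have ht' : |t| < δ := by simpa using ht
  simp only [Pi.sub_apply, mgf]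
  rw [integral_posPart_sub hf (hm t) (h t ht')]

variable {V : Type*} [NormedAddCommGroup V] [NormedSpace ℝ V] [CompleteSpace V]
  [SecondCountableTopology V] [MeasurableSpace V] [BorelSpace V]

/-- Completeness of an exponential family: a function whose integral against
`exp (L T)` vanishes for all small functionals `L` integrates to zero over every event determined
by `T`. Laplace transforms extend to characteristic functions by analytic continuation. -/
lemma setIntegral_preimage_eq_zero {f : 𝒳 → ℝ} {T : 𝒳 → V} (hf : Integrable f P)
    (hT : Measurable T) {ε : ℝ} (hε : 0 < ε)
    (hi : ∀ L : StrongDual ℝ V, ‖L‖ < ε → Integrable (fun x => f x * Real.exp (L (T x))) P)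
    (h0 : ∀ L : StrongDual ℝ V, ‖L‖ < ε → ∫ x, f x * Real.exp (L (T x)) ∂P = 0)
    {s : Set V} (hs : MeasurableSet s) : ∫ x in T ⁻¹' s, f x ∂P = 0 := by
  have := isFiniteMeasure_posPart hf
  have := isFiniteMeasure_posPart hf.neg
  have hmap : (posPart P f).map T = (posPart P (-f)).map T := by
    refine Measure.ext_of_charFunDual (funext fun L => ?_)
    obtain ⟨δ, hδ, hδL⟩ : ∃ δ > 0, ∀ t : ℝ, |t| < δ → ‖t • L‖ < ε := by
      refine ⟨ε / (‖L‖ + 1), by positivity, fun t ht => ?_⟩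
      rw [lt_div_iff₀ (by positivity)] at ht
      rw [norm_smul, Real.norm_eq_abs]
      nlinarith [abs_nonneg t, norm_nonneg L]
    set X : 𝒳 → ℝ := fun x => L (T x) with hX
    have hXm : Measurable X := L.continuous.measurable.comp hT
    have hm : ∀ t, Measurable fun x => Real.exp (t * X x) := fun t => by fun_prop
    have hi' : ∀ t, |t| < δ → Integrable (fun x => f x * Real.exp (t * X x)) P := by
      intro t ht
      simpa using hi (t • L) (hδL t ht)
    have hin' : ∀ t, |t| < δ → Integrable (fun x => (-f) x * Real.exp (t * X x)) P := by
      intro t ht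
      simpa using (hi' t ht).neg
    have hp := ball_subset_interior_integrableExpSet (X := X) (μ := posPart P f)
      fun t ht => integrable_posPart hf (hm t) (hi' t ht)
    have hn := ball_subset_interior_integrableExpSet (X := X) (μ := posPart P (-f))
      fun t ht => integrable_posPart hf.neg (hm t) (hin' t ht)
    have hmgf : ∀ t : ℝ, |t| < δ → mgf X (posPart P f) t = mgf X (posPart P (-f)) t := by
      intro t ht
      have h1 := integral_posPart_sub hf (hm t) (hi' t ht)
      have h2 := h0 (t • L) (hδL t ht)
      simp only [smul_apply, smul_eq_mul] at h2
      rw [h2, sub_eq_zero] at h1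
      exact h1
    have hAp : AnalyticOnNhd ℂ (complexMGF X (posPart P f)) {z | z.re ∈ Metric.ball (0 : ℝ) δ} :=
      analyticOnNhd_complexMGF.mono fun z hz => hp hz
    have hAn : AnalyticOnNhd ℂ (complexMGF X (posPart P (-f)))
        {z | z.re ∈ Metric.ball (0 : ℝ) δ} :=
      analyticOnNhd_complexMGF.mono fun z hz => hn hz
    have hEq := hAp.eqOn_of_preconnected_of_frequently_eq hAn
      ((convex_ball (0 : ℝ) δ).linear_preimage Complex.reLm).isPreconnected (z₀ := 0)
      (by simpa using hδ) (by
        have hr : ∃ᶠ t : ℝ in nhdsWithin 0 {0}ᶜ,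
            complexMGF X (posPart P f) t = complexMGF X (posPart P (-f)) t := by
          refine Filter.Eventually.frequently ?_
          filter_upwards [nhdsWithin_le_nhds (Metric.ball_mem_nhds (0 : ℝ) hδ)] with t ht
          rw [complexMGF_ofReal, complexMGF_ofReal, hmgf t (by simpa using ht)]
        have htend : Filter.Tendsto (fun t : ℝ => (t : ℂ)) (nhdsWithin 0 {0}ᶜ)
            (nhdsWithin 0 {0}ᶜ) := by
          refine tendsto_nhdsWithin_iff.2 ⟨?_, ?_⟩
          · exact (Complex.continuous_ofReal.tendsto' 0 0 (by simp)).mono_left nhdsWithin_le_nhds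
          · filter_upwards [self_mem_nhdsWithin] with t ht
            simpa using ht
        exact htend.frequently hr)
    have hI := hEq (show (Complex.I : ℂ) ∈ {z : ℂ | z.re ∈ Metric.ball (0 : ℝ) δ} by simpa using hδ)
    have hc : ∀ m : Measure 𝒳, charFunDual (m.map T) L = complexMGF X m Complex.I := by
      intro m
      rw [charFunDual_apply, integral_map hT.aemeasurable (by fun_prop)]
      simp [complexMGF, hX, mul_comm]
    rw [hc, hc, hI]
  have hpre := hT hs
  have hind : Integrable (fun x => f x * (T ⁻¹' s).indicator (fun _ => (1 : ℝ)) x) P := by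
    refine (hf.indicator hpre).congr (ae_of_all _ fun x => ?_)
    by_cases hx : x ∈ T ⁻¹' s <;> simp [hx]
  have h1 := integral_posPart_sub hf (measurable_const.indicator hpre) hind
  have h2 : ∀ m : Measure 𝒳, ∫ x, (T ⁻¹' s).indicator (fun _ => (1 : ℝ)) x ∂m
      = (m.map T).real s := by
    intro m
    rw [integral_indicator hpre, map_measureReal_apply hT hs]
    simp
  rw [h2, h2, hmap, sub_self] at h1
  rw [← integral_indicator hpre, h1]
  refine integral_congr_ae (ae_of_all _ fun x => ?_)
  by_cases hx : x ∈ T ⁻¹' s <;> simp [hx]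

end Signed

/-! ### Admissibility in exponential families with nuisance parameters -/

/-- If the conditional integrals of `h` against an exponential weight are nonpositive, and vanish
only where `h` does, while the total integral is nonnegative, then `h` vanishes. -/
lemma ae_eq_zero_of_conditional {V : Type*} [MeasurableSpace V] {Q : Measure (V × ℝ)}
    [IsFiniteMeasure Q] {h : V × ℝ → ℝ} {a : ℝ}
    (hie : Integrable (fun p => h p * Real.exp (a * p.2)) Q)
    (hint : 0 ≤ ∫ p, h p * Real.exp (a * p.2) ∂Q) (hm : AEStronglyMeasurable h Q)
    (hc : ∀ᵐ v ∂Q.fst, ∫ z, h (v, z) * Real.exp (a * z) ∂(Q.condKernel v) ≤ 0 ∧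
      (∫ z, h (v, z) * Real.exp (a * z) ∂(Q.condKernel v) = 0 →
        ∀ᵐ z ∂(Q.condKernel v), h (v, z) = 0)) : ∀ᵐ p ∂Q, h p = 0 := by
  have hI : Integrable (fun v => ∫ z, h (v, z) * Real.exp (a * z) ∂(Q.condKernel v)) Q.fst :=
    hie.integral_condKernel
  rw [← Measure.integral_condKernel hie] at hint
  have hz : ∫ v, ∫ z, h (v, z) * Real.exp (a * z) ∂(Q.condKernel v) ∂Q.fst = 0 :=
    le_antisymm (integral_nonpos_of_ae (hc.mono fun v hv => hv.1)) hint
  have hz' := ae_eq_zero_of_integral_eq_zero_of_sign hI (Or.inr (hc.mono fun v hv => hv.1)) hz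
  have hv : ∀ᵐ v ∂Q.fst, ∀ᵐ z ∂(Q.condKernel v), h (v, z) = 0 := by
    filter_upwards [hc, hz'] with v h1 h2 using h1.2 h2
  obtain ⟨h', hh'm, hh'⟩ := hm
  have h2 := hh'
  rw [← Q.disintegrate Q.condKernel] at h2
  have h3 : ∀ᵐ p ∂Q, h' p = 0 := by
    rw [← Q.disintegrate Q.condKernel]
    refine (Measure.ae_compProd_iff (hh'm.measurable (measurableSet_singleton 0))).2 ?_
    filter_upwards [hv, Measure.ae_ae_of_ae_compProd h2] with v h4 h5
    filter_upwards [h4, h5] with z h6 h7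
    change h' (v, z) = 0
    rw [← h7, h6]
  filter_upwards [hh', h3] with p h4 h5
  rw [h4, h5]

lemma ae_integral_condKernel_eq_zero {V : Type*} [MeasurableSpace V]
    {Q : Measure (V × ℝ)} [IsFiniteMeasure Q] {f : V × ℝ → ℝ}
    (hf : Integrable f Q) (h0 : ∀ s, MeasurableSet s → ∫ p in Prod.fst ⁻¹' s, f p ∂Q = 0) :
    ∀ᵐ v ∂Q.fst, ∫ z, f (v, z) ∂(Q.condKernel v) = 0 := by
  refine hf.integral_condKernel.ae_eq_zero_of_forall_setIntegral_eq_zero fun s hs _ => ?_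
  rw [Measure.setIntegral_condKernel_univ_right hs hf.integrableOn, Set.prod_univ]
  exact h0 s hs

section Admissible

variable {𝒳 Θ V : Type*} [MeasurableSpace 𝒳] [NormedAddCommGroup V] [NormedSpace ℝ V]
  [MeasurableSpace V]

/-- Near the member `P₀`, the model `P` contains the exponential family with natural statistics
`T` (for the nuisance parameters) and `Z` (for the parameter of interest). The real parameter `q`
has the sign of the coefficient of `Z`, and the data can be recovered from `(T, Z)`. -/
structure IsLocalExpFamily (P : Θ → Measure 𝒳) (P₀ : Measure 𝒳) (T : 𝒳 → V) (Z : 𝒳 → ℝ)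
    (q : Θ → ℝ) : Prop where
  isProb : ∀ θ, IsProbabilityMeasure (P θ)
  isFinite : IsFiniteMeasure P₀
  ac : ∀ θ, P θ ≪ P₀
  measurable_T : Measurable T
  measurable_Z : Measurable Z
  exists_inverse : ∃ g : V × ℝ → 𝒳, Measurable g ∧ ∀ x, g (T x, Z x) = x
  exists_tilt : ∃ ε > 0, ∀ (L : StrongDual ℝ V) (a : ℝ), ‖L‖ < ε → |a| < ε →
    ∃ θ, SignType.sign (q θ) = SignType.sign a ∧ ∃ c : ENNReal, c ≠ 0 ∧ c ≠ ⊤ ∧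
      P θ = c • P₀.withDensity fun x => ENNReal.ofReal (Real.exp (L (T x) + a * Z x))

namespace IsLocalExpFamily

variable {P : Θ → Measure 𝒳} {P₀ : Measure 𝒳} {T : 𝒳 → V} {Z : 𝒳 → ℝ} {q : Θ → ℝ}

/-- Admissibility from uniqueness: if every function `h` that could be the difference `φ' - φ`
between a better test and `φ` vanishes almost everywhere, then `φ` is admissible. -/
lemma isAdmissibleTest_of_ae_eq_zero (hP : IsLocalExpFamily P P₀ T Z q) {φ : 𝒳 → ℝ}
    (hφ : IsTest P φ) {H K : Set Θ}
    (hu : ∀ h : 𝒳 → ℝ, AEMeasurable h P₀ → (∀ x, |h x| ≤ 1) → (∀ x, φ x = 0 → 0 ≤ h x) →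
      (∀ x, φ x = 1 → h x ≤ 0) → (∀ θ ∈ H, ∫ x, h x ∂(P θ) ≤ 0) →
      (∀ θ ∈ K, 0 ≤ ∫ x, h x ∂(P θ)) → ∀ᵐ x ∂P₀, h x = 0) :
    IsAdmissibleTest P H K φ := by
  have := hP.isProb
  refine ⟨hφ, ?_⟩
  rintro ⟨φ', hφ', hH, hK, hstrict⟩
  have hint : ∀ {ψ : 𝒳 → ℝ}, IsTest P ψ → ∀ θ, Integrable ψ (P θ) := by
    intro ψ hψ θ
    refine Integrable.of_bound (hψ.1 θ).aestronglyMeasurable 1 (ae_of_all _ fun x => ?_)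
    rw [Real.norm_eq_abs, abs_le]
    constructor <;> linarith [(hψ.2 x).1, (hψ.2 x).2]
  have hsub : ∀ θ, ∫ x, (φ' x - φ x) ∂(P θ) = ∫ x, φ' x ∂(P θ) - ∫ x, φ x ∂(P θ) := fun θ =>
    integral_sub (hint hφ' θ) (hint hφ θ)
  have hmeas : ∀ {ψ : 𝒳 → ℝ}, IsTest P ψ → AEMeasurable ψ P₀ := by
    intro ψ hψ
    obtain ⟨ε, hε, htilt⟩ := hP.exists_tilt
    obtain ⟨θ, -, c, hc0, -, hc⟩ := htilt 0 0 (by simpa using hε) (by simpa using hε)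
    have h1 := hψ.1 θ
    rw [hc] at h1
    simp only [zero_apply, zero_mul, add_zero, Real.exp_zero, ENNReal.ofReal_one] at h1
    rw [show (fun _ : 𝒳 => (1 : ENNReal)) = 1 from rfl, withDensity_one] at h1
    exact h1.mono_ac (Measure.absolutelyContinuous_smul hc0)
  have hz := hu (fun x => φ' x - φ x) ((hmeas hφ').sub (hmeas hφ))
    (fun x => by
      rw [abs_le]
      constructor <;> linarith [(hφ.2 x).1, (hφ.2 x).2, (hφ'.2 x).1, (hφ'.2 x).2])
    (fun x hx => by linarith [(hφ'.2 x).1]) (fun x hx => by linarith [(hφ'.2 x).2])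
    (fun θ hθ => by rw [hsub]; linarith [hH θ hθ]) (fun θ hθ => by rw [hsub]; linarith [hK θ hθ])
  have heq : ∀ θ, ∫ x, φ' x ∂(P θ) = ∫ x, φ x ∂(P θ) := by
    intro θ
    refine integral_congr_ae ?_
    filter_upwards [(hP.ac θ).ae_le hz] with x hx
    linarith
  rcases hstrict with ⟨θ, -, h⟩ | ⟨θ, -, h⟩ <;> exact absurd (heq θ) (by linarith)

variable [CompleteSpace V] [SecondCountableTopology V] [BorelSpace V]

/-- The core of the admissibility proof. If `h` has nonpositive expectation on the null hypothesis
and nonnegative expectation on the alternative, and has the sign pattern of a difference of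
critical functions on the sections `T = v`, then `h` vanishes. The set `A` consists of the points
`(v, z)` of the acceptance region. -/
lemma ae_eq_zero (hP : IsLocalExpFamily P P₀ T Z q) {h : 𝒳 → ℝ} (hm : AEMeasurable h P₀)
    (hb : ∀ x, |h x| ≤ 1) (hH : ∀ θ, q θ = 0 → ∫ x, h x ∂(P θ) ≤ 0)
    (hK : ∀ θ, 0 < q θ → 0 ≤ ∫ x, h x ∂(P θ)) (A : Set (V × ℝ))
    (hpos : ∀ᵐ x ∂P₀, (T x, Z x) ∈ A → 0 ≤ h x) (hneg : ∀ᵐ x ∂P₀, (T x, Z x) ∉ A → h x ≤ 0)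
    (hA : (∀ v, IsLowerSet {z | (v, z) ∈ A}) ∨
      (∀ θ, q θ < 0 → 0 ≤ ∫ x, h x ∂(P θ)) ∧ ∀ v, Set.OrdConnected {z | (v, z) ∈ A}) :
    ∀ᵐ x ∂P₀, h x = 0 := by
  have := hP.isFinite
  have := hP.isProb
  obtain ⟨g, hg, hgx⟩ := hP.exists_inverse
  obtain ⟨ε, hε, htilt⟩ := hP.exists_tilt
  have hT := hP.measurable_T
  have hZ := hP.measurable_Z
  have hexpm : ∀ (L : StrongDual ℝ V) (a : ℝ),
      Measurable fun x => Real.exp (L (T x) + a * Z x) := fun L a =>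
    ((L.continuous.measurable.comp hT).add (hZ.const_mul a)).exp
  -- the weights are integrable because the members of the model are finite measures
  have hexpi : ∀ (L : StrongDual ℝ V) (a : ℝ), ‖L‖ < ε → |a| < ε →
      Integrable (fun x => Real.exp (L (T x) + a * Z x)) P₀ := by
    intro L a hL ha
    obtain ⟨θ, -, c, hc0, hct, hPθ⟩ := htilt L a hL ha
    refine ⟨(hexpm L a).aestronglyMeasurable, ?_⟩
    rw [hasFiniteIntegral_iff_ofReal (ae_of_all _ fun x => (Real.exp_pos _).le)]
    have h1 : P θ Set.univ = 1 := measure_univ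
    rw [hPθ, Measure.smul_apply, withDensity_apply _ MeasurableSet.univ, Measure.restrict_univ,
      smul_eq_mul] at h1
    refine lt_of_le_of_ne le_top fun htop => ?_
    rw [htop, ENNReal.mul_top hc0] at h1
    exact ENNReal.top_ne_one h1
  have hint : ∀ (L : StrongDual ℝ V) (a : ℝ), ‖L‖ < ε → |a| < ε →
      Integrable (fun x => h x * Real.exp (L (T x) + a * Z x)) P₀ := by
    intro L a hL ha
    exact (hexpi L a hL ha).bdd_mul hm.aestronglyMeasurable (c := 1)
      (ae_of_all _ fun x => by simpa using hb x)
  have hval : ∀ (L : StrongDual ℝ V) (a : ℝ), ‖L‖ < ε → |a| < ε →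
      ∃ θ, SignType.sign (q θ) = SignType.sign a ∧ ∃ c > 0, ∫ x, h x ∂(P θ)
        = c * ∫ x, h x * Real.exp (L (T x) + a * Z x) ∂P₀ := by
    intro L a hL ha
    obtain ⟨θ, hq, c, hc0, hct, hPθ⟩ := htilt L a hL ha
    refine ⟨θ, hq, c.toReal, ENNReal.toReal_pos hc0 hct, ?_⟩
    rw [hPθ, integral_smul_measure, integral_withDensity_eq_integral_toReal_smul₀
      (hexpm L a).ennreal_ofReal.aemeasurable (ae_of_all _ fun x => ENNReal.ofReal_lt_top),
      smul_eq_mul]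
    congr 1
    refine integral_congr_ae (ae_of_all _ fun x => ?_)
    simp only [smul_eq_mul]
    rw [ENNReal.toReal_ofReal (Real.exp_pos _).le, mul_comm]
  have hGpos : ∀ (L : StrongDual ℝ V) (a : ℝ), ‖L‖ < ε → |a| < ε → 0 < a →
      0 ≤ ∫ x, h x * Real.exp (L (T x) + a * Z x) ∂P₀ := by
    intro L a hL ha ha0
    obtain ⟨θ, hq, c, hc, h1⟩ := hval L a hL ha
    rw [sign_pos ha0, sign_eq_one_iff] at hq
    have h2 := hK θ hq
    rw [h1] at h2
    exact nonneg_of_mul_nonneg_right h2 hc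
  have hi0 : ∀ (L : StrongDual ℝ V), ‖L‖ < ε →
      Integrable (fun x => h x * Real.exp (L (T x))) P₀ := by
    intro L hL
    simpa using hint L 0 hL (by simpa using hε)
  -- differentiation along the parameter of interest
  have hderiv : ∀ (L : StrongDual ℝ V), ‖L‖ < ε →
      Integrable (fun x => h x * Real.exp (L (T x)) * Z x) P₀ ∧
      HasDerivAt (fun a => ∫ x, h x * Real.exp (L (T x) + a * Z x) ∂P₀)
        (∫ x, h x * Real.exp (L (T x)) * Z x ∂P₀) 0 := by
    intro L hL
    have h1 := hasDerivAt_integral_mul_exp (hi0 L hL) hZ hε (fun a ha => by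
      simpa only [Real.exp_add, mul_assoc] using hint L a hL ha)
    simpa only [Real.exp_add, mul_assoc] using h1
  have hG0 : ∀ (L : StrongDual ℝ V), ‖L‖ < ε → ∫ x, h x * Real.exp (L (T x)) ∂P₀ = 0 := by
    intro L hL
    refine le_antisymm ?_ ?_
    · obtain ⟨θ, hq, c, hc, h1⟩ := hval L 0 hL (by simpa using hε)
      rw [sign_zero, sign_eq_zero_iff] at hq
      have h2 := hH θ hq
      rw [h1] at h2
      simpa using nonpos_of_mul_nonpos_right h2 hc
    · have hc := (hderiv L hL).2.continuousAt.tendsto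
      simp only [zero_mul, add_zero] at hc
      refine ge_of_tendsto (hc.mono_left (nhdsWithin_le_nhds (s := Set.Ioi 0))) ?_
      filter_upwards [self_mem_nhdsWithin,
        nhdsWithin_le_nhds (Metric.ball_mem_nhds (0 : ℝ) hε)] with a ha0 ha
      exact hGpos L a hL (by simpa using ha) ha0
  have hih : Integrable h P₀ := by simpa using hi0 0 (by simpa using hε)
  -- transfer to the space of the natural statistics
  have hTZ : Measurable fun x => (T x, Z x) := hT.prodMk hZ
  set Q : Measure (V × ℝ) := P₀.map fun x => (T x, Z x) with hQ
  have hQg : Q.map g = P₀ := by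
    rw [hQ, Measure.map_map hg hTZ]
    have : g ∘ (fun x => (T x, Z x)) = id := funext hgx
    rw [this, Measure.map_id]
  have hmg : AEMeasurable (fun p => h (g p)) Q := by
    refine AEMeasurable.comp_measurable (g := h) ?_ hg
    rwa [hQg]
  have htrans : ∀ F : V × ℝ → ℝ, Measurable F →
      (Integrable (fun p => h (g p) * F p) Q ↔ Integrable (fun x => h x * F (T x, Z x)) P₀) ∧
      ∀ s, MeasurableSet s → ∫ p in Prod.fst ⁻¹' s, h (g p) * F p ∂Q
        = ∫ x in T ⁻¹' s, h x * F (T x, Z x) ∂P₀ := by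
    intro F hF
    have h1 : AEStronglyMeasurable (fun p => h (g p) * F p) Q :=
      (hmg.mul hF.aemeasurable).aestronglyMeasurable
    refine ⟨?_, fun s hs => ?_⟩
    · rw [hQ, integrable_map_measure h1 hTZ.aemeasurable]
      simp only [Function.comp_def, hgx]
    · rw [hQ, setIntegral_map (measurable_fst hs) h1 hTZ.aemeasurable]
      simp only [hgx]
      rfl
  have hQae : ∀ p : V × ℝ → Prop, (∀ᵐ x ∂P₀, p (T x, Z x)) → ∀ᵐ y ∂Q.fst,
      ∀ᵐ z ∂(Q.condKernel y), p (y, z) := by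
    intro p hp
    -- `p` need not be measurable, so the inverse map is used to carry it over to `Q`
    have hfix : ∀ᵐ y ∂Q, (T (g y), Z (g y)) = y := by
      have hms : MeasurableSet {y : V × ℝ | (T (g y), Z (g y)) = y} :=
        measurableSet_eq_fun (hTZ.comp hg) measurable_id
      rw [hQ, ae_map_iff hTZ.aemeasurable hms]
      simp [hgx]
    have hpg : ∀ᵐ y ∂Q, p (T (g y), Z (g y)) := by
      rw [← hQg] at hp
      exact ae_of_ae_map hg.aemeasurable hp
    have hpQ : ∀ᵐ y ∂Q, p y := by
      filter_upwards [hfix, hpg] with y h1 h2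
      rwa [h1] at h2
    rw [← Q.disintegrate Q.condKernel] at hpQ
    exact Measure.ae_ae_of_ae_compProd hpQ
  obtain ⟨a, ha, haε⟩ : ∃ a : ℝ, 0 < a ∧ |a| < ε :=
    ⟨ε / 2, by positivity, by rw [abs_of_pos (by positivity)]; linarith⟩
  have hQi : Integrable (fun p => h (g p)) Q := by
    simpa using (htrans (fun _ => 1) measurable_const).1.2 (by simpa using hih)
  have hQie : Integrable (fun p => h (g p) * Real.exp (a * p.2)) Q := by
    refine (htrans (fun p => Real.exp (a * p.2)) (by fun_prop)).1.2 ?_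
    simpa using hint 0 a (by simpa using hε) haε
  have hQ0 : ∀ᵐ v ∂Q.fst, ∫ z, h (g (v, z)) ∂(Q.condKernel v) = 0 := by
    refine ae_integral_condKernel_eq_zero hQi fun s hs => ?_
    have h1 := (htrans (fun _ => 1) measurable_const).2 s hs
    simp only [mul_one] at h1
    rw [h1]
    exact setIntegral_preimage_eq_zero hih hT hε hi0 hG0 hs
  have hconc : ∀ᵐ v ∂Q.fst, ∫ z, h (g (v, z)) * Real.exp (a * z) ∂(Q.condKernel v) ≤ 0 ∧
      (∫ z, h (g (v, z)) * Real.exp (a * z) ∂(Q.condKernel v) = 0 →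
        ∀ᵐ z ∂(Q.condKernel v), h (g (v, z)) = 0) := by
    have hp := hQae (fun p => p ∈ A → 0 ≤ h (g p)) (by simpa only [hgx] using hpos)
    have hn := hQae (fun p => p ∉ A → h (g p) ≤ 0) (by simpa only [hgx] using hneg)
    rcases hA with hA | ⟨hK', hA⟩
    · filter_upwards [hp, hn, hQ0, hQi.condKernel_ae, hQie.condKernel_ae] with v h1 h2 h3 h4 h5
      exact integral_mul_exp_nonpos_of_isLowerSet (hA v) h1 h2 h4 h3 ha h5
    · have hGneg : ∀ (L : StrongDual ℝ V) (a : ℝ), ‖L‖ < ε → |a| < ε → a < 0 →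
          0 ≤ ∫ x, h x * Real.exp (L (T x) + a * Z x) ∂P₀ := by
        intro L a hL ha ha0
        obtain ⟨θ, hq, c, hc, h1⟩ := hval L a hL ha
        rw [sign_neg ha0, sign_eq_neg_one_iff] at hq
        have h2 := hK' θ hq
        rw [h1] at h2
        exact nonneg_of_mul_nonneg_right h2 hc
      -- the power function has a minimum on the null hypothesis, so its derivative vanishes
      have hD0 : ∀ (L : StrongDual ℝ V), ‖L‖ < ε →
          ∫ x, h x * Real.exp (L (T x)) * Z x ∂P₀ = 0 := by
        intro L hL
        refine IsLocalMin.hasDerivAt_eq_zero ?_ (hderiv L hL).2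
        filter_upwards [Metric.ball_mem_nhds (0 : ℝ) hε] with a ha
        simp only [zero_mul, add_zero]
        rw [hG0 L hL]
        have ha' : |a| < ε := by simpa using ha
        rcases lt_trichotomy a 0 with h1 | h1 | h1
        · exact hGneg L a hL ha' h1
        · simp [h1, hG0 L hL]
        · exact hGpos L a hL ha' h1
      have hihZ : Integrable (fun x => h x * Z x) P₀ := by
        simpa using (hderiv 0 (by simpa using hε)).1
      have hQiZ : Integrable (fun p => h (g p) * p.2) Q :=
        (htrans Prod.snd measurable_snd).1.2 hihZ
      have hQZ0 : ∀ᵐ v ∂Q.fst, ∫ z, h (g (v, z)) * z ∂(Q.condKernel v) = 0 := by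
        refine ae_integral_condKernel_eq_zero hQiZ fun s hs => ?_
        rw [(htrans Prod.snd measurable_snd).2 s hs]
        refine setIntegral_preimage_eq_zero hihZ hT hε (fun L hL => ?_) (fun L hL => ?_) hs
        · simpa only [mul_right_comm] using (hderiv L hL).1
        · simpa only [mul_right_comm] using hD0 L hL
      filter_upwards [hp, hn, hQ0, hQi.condKernel_ae, hQie.condKernel_ae, hQZ0,
        hQiZ.condKernel_ae] with v h1 h2 h3 h4 h5 h6 h7
      exact integral_mul_exp_nonpos_of_ordConnected (hA v) h1 h2 h4 h3 h7 h6 ha h5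
  have hfin := ae_eq_zero_of_conditional (h := fun p => h (g p)) hQie (by
    have h1 := (htrans (fun p => Real.exp (a * p.2)) (by fun_prop)).2 Set.univ MeasurableSet.univ
    simp only [Set.preimage_univ, Measure.restrict_univ] at h1
    rw [h1]
    simpa using hGpos 0 a (by simpa using hε) haε ha) hmg.aestronglyMeasurable hconc
  have := ae_of_ae_map hTZ.aemeasurable hfin
  simpa only [hgx] using this

/-- A test of `q = 0` against `q ≠ 0` whose acceptance region has convex sections, up to a null
set, is admissible. -/
theorem isAdmissibleTest_of_ordConnected (hP : IsLocalExpFamily P P₀ T Z q) {φ : 𝒳 → ℝ}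
    (hφ : IsTest P φ) (h01 : ∀ x, φ x = 0 ∨ φ x = 1) {G : Set 𝒳} (hG : ∀ᵐ x ∂P₀, x ∈ G)
    (hsec : ∀ x₁ ∈ G, ∀ x₂ ∈ G, ∀ x₃ ∈ G, T x₁ = T x₂ → T x₃ = T x₂ → Z x₁ ≤ Z x₂ →
      Z x₂ ≤ Z x₃ → φ x₁ = 0 → φ x₃ = 0 → φ x₂ = 0) :
    IsAdmissibleTest P {θ | q θ = 0} {θ | q θ ≠ 0} φ := by
  refine hP.isAdmissibleTest_of_ae_eq_zero hφ fun h hm hb hp hn hH hK => ?_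
  refine hP.ae_eq_zero hm hb (fun θ hθ => hH θ hθ) (fun θ hθ => hK θ hθ.ne')
    {p | ∃ x₁ ∈ G, ∃ x₃ ∈ G, T x₁ = p.1 ∧ T x₃ = p.1 ∧ Z x₁ ≤ p.2 ∧ p.2 ≤ Z x₃ ∧
      φ x₁ = 0 ∧ φ x₃ = 0} ?_ ?_ (Or.inr ⟨fun θ hθ => hK θ hθ.ne, fun v => ⟨?_⟩⟩)
  · filter_upwards [hG] with x hx
    rintro ⟨x₁, h1, x₃, h3, hT1, hT3, hZ1, hZ3, h10, h30⟩
    exact hp x (hsec x₁ h1 x hx x₃ h3 hT1 hT3 hZ1 hZ3 h10 h30)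
  · filter_upwards [hG] with x hx hxA
    refine hn x ((h01 x).resolve_left fun h0 => hxA ?_)
    exact ⟨x, hx, x, hx, rfl, rfl, le_rfl, le_rfl, h0, h0⟩
  · rintro z ⟨x₁, h1, -, -, hT1, -, hZ1, -, h10, -⟩ z' ⟨-, -, x₃, h3, -, hT3, -, hZ3, -, h30⟩ w hw
    exact ⟨x₁, h1, x₃, h3, hT1, hT3, hZ1.trans hw.1, hw.2.trans hZ3, h10, h30⟩

/-- A test against `q > 0` whose acceptance region has half-lines as sections, up to a null set,
is admissible, both for `q = 0` and for larger null hypotheses. -/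
theorem isAdmissibleTest_of_isLowerSet (hP : IsLocalExpFamily P P₀ T Z q) {φ : 𝒳 → ℝ}
    (hφ : IsTest P φ) (h01 : ∀ x, φ x = 0 ∨ φ x = 1) {G : Set 𝒳} (hG : ∀ᵐ x ∂P₀, x ∈ G)
    (hsec : ∀ x₂ ∈ G, ∀ x₃ ∈ G, T x₃ = T x₂ → Z x₂ ≤ Z x₃ → φ x₃ = 0 → φ x₂ = 0)
    {H : Set Θ} (hH0 : ∀ θ, q θ = 0 → θ ∈ H) :
    IsAdmissibleTest P H {θ | 0 < q θ} φ := by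
  refine hP.isAdmissibleTest_of_ae_eq_zero hφ fun h hm hb hp hn hH hK => ?_
  refine hP.ae_eq_zero hm hb (fun θ hθ => hH θ (hH0 θ hθ)) (fun θ hθ => hK θ hθ)
    {p | ∃ x₃ ∈ G, T x₃ = p.1 ∧ p.2 ≤ Z x₃ ∧ φ x₃ = 0} ?_ ?_ (Or.inl fun v => ?_)
  · filter_upwards [hG] with x hx
    rintro ⟨x₃, h3, hT3, hZ3, h30⟩
    exact hp x (hsec x hx x₃ h3 hT3 hZ3 h30)
  · filter_upwards [hG] with x hx hxA
    refine hn x ((h01 x).resolve_left fun h0 => hxA ?_)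
    exact ⟨x, hx, rfl, le_rfl, h0⟩
  · rintro z w hwz ⟨x₃, h3, hT3, hZ3, h30⟩
    exact ⟨x₃, h3, hT3, le_trans hwz hZ3, h30⟩

end IsLocalExpFamily

end Admissible

/-! ### Sections of the acceptance regions of a step-down procedure -/

section StepDown

variable {𝒳 : Type*} {M : ℕ} {stat : Finset (Fin M) → Fin M → 𝒳 → ℝ}
  {sel : 𝒳 → Finset (Fin M) → Fin M} {C : Fin M → ℝ}

/-- No two competing statistics take the same value at `x`. -/
def NoTies (stat : Finset (Fin M) → Fin M → 𝒳 → ℝ) (x : 𝒳) : Prop :=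
  ∀ E j k, j ∉ E → k ∉ E → j ≠ k → stat E j x ≠ stat E k x

lemma IsMaximizer.sel_eq (hsel : IsMaximizer stat sel) {x : 𝒳} (hx : NoTies stat x)
    {E : Finset (Fin M)} (hE : E ≠ Finset.univ) {j : Fin M} (hj : j ∉ E)
    (h : stat E (sel x E) x ≤ stat E j x) : sel x E = j := by
  by_contra hne
  exact hx E _ _ (hsel x E hE).1 hj hne (le_antisymm h ((hsel x E hE).2 j hj))

lemma subset_step (x : 𝒳) (E : Finset (Fin M)) : E ⊆ step stat sel C x E := by
  unfold step
  split_ifs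
  · exact Finset.subset_insert _ _
  · exact subset_rfl
  · exact subset_rfl

/-- As long as the `i`-th hypothesis is accepted at the outer points, a stage of the procedure acts
in the same way at all three points. Without ties, the `i`-th statistic at the middle point cannot
reach the largest of the other statistics. -/
lemma step_eq_of_sections (hsel : IsMaximizer stat sel) {i : Fin M} {x₁ x₂ x₃ : 𝒳}
    (hx₁ : NoTies stat x₁) (hx₂ : NoTies stat x₂) (hx₃ : NoTies stat x₃) {E : Finset (Fin M)}
    (hi : i ∉ E) (h12 : ∀ j, j ∉ E → j ≠ i → stat E j x₁ = stat E j x₂)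
    (h32 : ∀ j, j ∉ E → j ≠ i → stat E j x₃ = stat E j x₂)
    (hmax : stat E i x₂ ≤ max (stat E i x₁) (stat E i x₃))
    (h1 : i ∉ step stat sel C x₁ E) (h3 : i ∉ step stat sel C x₃ E) :
    step stat sel C x₁ E = step stat sel C x₂ E ∧
      step stat sel C x₃ E = step stat sel C x₂ E := by
  have hE : E ≠ Finset.univ := fun h => hi (h ▸ Finset.mem_univ i)
  have hcard : E.card < M := by
    have := Finset.card_lt_univ_of_notMem hi
    simpa using this
  simp only [step, hcard, dif_pos] at h1 h3 ⊢
  -- if one of the outer points rejects, then all three points select the same index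
  have key : ∀ y y' : 𝒳, NoTies stat y → NoTies stat y' →
      (∀ j, j ∉ E → j ≠ i → stat E j y = stat E j x₂) →
      (∀ j, j ∉ E → j ≠ i → stat E j y' = stat E j x₂) →
      stat E i x₂ ≤ max (stat E i y) (stat E i y') →
      (C ⟨E.card, hcard⟩ ≤ stat E (sel y E) y → sel y E ≠ i) →
      (C ⟨E.card, hcard⟩ ≤ stat E (sel y' E) y' → sel y' E ≠ i) →
      C ⟨E.card, hcard⟩ ≤ stat E (sel y E) y →
      sel x₂ E = sel y E ∧ sel y' E = sel y E ∧ C ⟨E.card, hcard⟩ ≤ stat E (sel x₂ E) x₂ ∧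
        C ⟨E.card, hcard⟩ ≤ stat E (sel y' E) y' := by
    intro y y' hy hy' hyj hyj' hm hyi hyi' hC
    have hj := (hsel y E hE).1
    have hji := hyi hC
    have hj2 := hyj _ hj hji
    have hj' := hyj' _ hj hji
    have hC' : C ⟨E.card, hcard⟩ ≤ stat E (sel y' E) y' := by
      refine le_trans ?_ ((hsel y' E hE).2 _ hj)
      rwa [hj', ← hj2]
    have hs' : sel y' E = sel y E := by
      refine hsel.sel_eq hy' hE hj ?_
      rw [hj', ← hj2, hyj' _ (hsel y' E hE).1 (hyi' hC'), ← hyj _ (hsel y' E hE).1 (hyi' hC')]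
      exact (hsel y E hE).2 _ (hsel y' E hE).1
    have hs2 : sel x₂ E = sel y E := by
      refine hsel.sel_eq hx₂ hE hj ?_
      by_cases hi2 : sel x₂ E = i
      · rw [hi2]
        refine hm.trans (max_le ?_ ?_)
        · rw [← hj2]
          exact (hsel y E hE).2 i hi
        · rw [← hj', ← hs']
          exact (hsel y' E hE).2 i hi
      · rw [← hyj _ (hsel x₂ E hE).1 hi2, ← hj2]
        exact (hsel y E hE).2 _ (hsel x₂ E hE).1
    refine ⟨hs2, hs', ?_, hC'⟩
    rw [hs2, ← hj2]
    exact hC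
  have hi1 : C ⟨E.card, hcard⟩ ≤ stat E (sel x₁ E) x₁ → sel x₁ E ≠ i := by
    intro hC heq
    rw [if_pos hC, heq] at h1
    exact h1 (Finset.mem_insert_self _ _)
  have hi3 : C ⟨E.card, hcard⟩ ≤ stat E (sel x₃ E) x₃ → sel x₃ E ≠ i := by
    intro hC heq
    rw [if_pos hC, heq] at h3
    exact h3 (Finset.mem_insert_self _ _)
  by_cases hC1 : C ⟨E.card, hcard⟩ ≤ stat E (sel x₁ E) x₁
  · obtain ⟨k1, k2, k3, k4⟩ := key x₁ x₃ hx₁ hx₃ h12 h32 hmax hi1 hi3 hC1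
    rw [if_pos hC1, if_pos k3, if_pos k4, k1, k2]
    exact ⟨rfl, rfl⟩
  by_cases hC3 : C ⟨E.card, hcard⟩ ≤ stat E (sel x₃ E) x₃
  · obtain ⟨k1, k2, k3, k4⟩ := key x₃ x₁ hx₃ hx₁ h32 h12 (by rwa [max_comm]) hi3 hi1 hC3
    exact absurd k4 hC1
  have hC2 : ¬ C ⟨E.card, hcard⟩ ≤ stat E (sel x₂ E) x₂ := by
    push Not at hC1 hC3 ⊢
    by_cases hi2 : sel x₂ E = i
    · rw [hi2]
      exact hmax.trans_lt (max_lt (((hsel x₁ E hE).2 i hi).trans_lt hC1)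
        (((hsel x₃ E hE).2 i hi).trans_lt hC3))
    · rw [← h12 _ (hsel x₂ E hE).1 hi2]
      exact ((hsel x₁ E hE).2 _ (hsel x₂ E hE).1).trans_lt hC1
  rw [if_neg hC1, if_neg hC2, if_neg hC3]
  exact ⟨rfl, rfl⟩

/-- The acceptance region of the `i`-th individual test has convex sections: if the statistics of
the other hypotheses agree at `x₁`, `x₂` and `x₃`, and the `i`-th statistic at `x₂` never exceeds
both other values, then acceptance of the `i`-th hypothesis at `x₁` and `x₃` entails acceptance
at `x₂`. -/
theorem notMem_rejected_of_sections (hsel : IsMaximizer stat sel) {i : Fin M} {x₁ x₂ x₃ : 𝒳}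
    (hx₁ : NoTies stat x₁) (hx₂ : NoTies stat x₂) (hx₃ : NoTies stat x₃)
    (h12 : ∀ E j, i ∉ E → j ∉ E → j ≠ i → stat E j x₁ = stat E j x₂)
    (h32 : ∀ E j, i ∉ E → j ∉ E → j ≠ i → stat E j x₃ = stat E j x₂)
    (hmax : ∀ E, i ∉ E → stat E i x₂ ≤ max (stat E i x₁) (stat E i x₃))
    (h1 : i ∉ rejected stat sel C x₁) (h3 : i ∉ rejected stat sel C x₃) :
    i ∉ rejected stat sel C x₂ := by
  have key : ∀ n, i ∉ (step stat sel C x₁)^[n] ∅ → i ∉ (step stat sel C x₃)^[n] ∅ →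
      (step stat sel C x₁)^[n] ∅ = (step stat sel C x₂)^[n] ∅ ∧
        (step stat sel C x₃)^[n] ∅ = (step stat sel C x₂)^[n] ∅ := by
    intro n
    induction n with
    | zero => intro _ _; exact ⟨rfl, rfl⟩
    | succ n ih =>
      intro k1 k3
      rw [Function.iterate_succ_apply'] at k1 k3
      obtain ⟨e1, e3⟩ := ih (fun h => k1 (subset_step _ _ h)) (fun h => k3 (subset_step _ _ h))
      have hiE : i ∉ (step stat sel C x₂)^[n] ∅ := by
        rw [← e1]
        exact fun h => k1 (subset_step _ _ h)
      simp only [Function.iterate_succ_apply']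
      rw [e1] at k1 ⊢
      rw [e3] at k3 ⊢
      exact step_eq_of_sections hsel hx₁ hx₂ hx₃ hiE (fun j => h12 _ j hiE)
        (fun j => h32 _ j hiE) (hmax _ hiE) k1 k3
  obtain ⟨e1, -⟩ := key M h1 h3
  intro h
  refine h1 ?_
  unfold rejected at h ⊢
  rwa [e1]

lemma individualTest_eq_zero_iff {R : 𝒳 → Finset (Fin M)} {i : Fin M} {x : 𝒳} :
    individualTest R i x = 0 ↔ i ∉ R x := by
  unfold individualTest
  split_ifs with h <;> simp [h]

lemma individualTest_eq_zero_or_one (R : 𝒳 → Finset (Fin M)) (i : Fin M) (x : 𝒳) :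
    individualTest R i x = 0 ∨ individualTest R i x = 1 := by
  unfold individualTest
  split_ifs <;> simp

/-- Off the null set of ties the selected index is determined by finitely many comparisons, so
the individual tests are measurable up to null sets, whatever the tie-breaking rule. -/
lemma aemeasurable_individualTest [MeasurableSpace 𝒳] {P : Measure 𝒳}
    (hsel : IsMaximizer stat sel) (hstat : ∀ E j, Measurable (stat E j))
    (hties : ∀ᵐ x ∂P, NoTies stat x) (i : Fin M) :
    AEMeasurable (individualTest (rejected stat sel C) i) P := by
  classical
  have hset : ∀ (E : Finset (Fin M)) (_ : E ≠ Finset.univ) (j : Fin M),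
      NullMeasurableSet {x | sel x E = j} P := by
    intro E hE j
    have hm : MeasurableSet {x | j ∉ E ∧ ∀ k, k ∉ E → stat E k x ≤ stat E j x} := by
      refine (MeasurableSet.const _).inter ?_
      have : {x | ∀ k, k ∉ E → stat E k x ≤ stat E j x}
          = ⋂ k : Fin M, {x | k ∉ E → stat E k x ≤ stat E j x} := by
        ext x; simp
      change MeasurableSet {x | ∀ k, k ∉ E → stat E k x ≤ stat E j x}
      rw [this]
      refine MeasurableSet.iInter fun k => ?_
      by_cases hk : k ∈ E
      · simp [hk]
      · simpa [hk] using measurableSet_le (hstat E k) (hstat E j)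
    refine hm.nullMeasurableSet.congr ?_
    filter_upwards [hties] with x hx
    refine propext ⟨fun h => hsel.sel_eq hx hE h.1 (h.2 _ (hsel x E hE).1), ?_⟩
    rintro rfl
    exact hsel x E hE
  have hstep : ∀ E F : Finset (Fin M), NullMeasurableSet {x | step stat sel C x E = F} P := by
    intro E F
    by_cases hcard : E.card < M
    swap
    · simp only [step, hcard, dif_neg, not_false_eq_true]
      exact (MeasurableSet.const _).nullMeasurableSet
    have hE : E ≠ Finset.univ := by
      rintro rfl
      simp at hcard
    have : {x | step stat sel C x E = F} = ⋃ j, {x | sel x E = j} ∩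
        {x | (if C ⟨E.card, hcard⟩ ≤ stat E j x then insert j E else E) = F} := by
      ext x
      simp [step, hcard]
    rw [this]
    refine NullMeasurableSet.iUnion fun j => (hset E hE j).inter ?_
    refine MeasurableSet.nullMeasurableSet ?_
    have hms : MeasurableSet {x | C ⟨E.card, hcard⟩ ≤ stat E j x} :=
      measurableSet_le measurable_const (hstat E j)
    let _ : MeasurableSpace (Finset (Fin M)) := ⊤
    have hf : Measurable fun x => if C ⟨E.card, hcard⟩ ≤ stat E j x then insert j E else E :=
      Measurable.ite hms measurable_const measurable_const
    exact hf (MeasurableSpace.measurableSet_top (s := {F}))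
  have hiter : ∀ n (F : Finset (Fin M)),
      NullMeasurableSet {x | (step stat sel C x)^[n] ∅ = F} P := by
    intro n
    induction n with
    | zero =>
      intro F
      simp only [Function.iterate_zero, id_eq]
      exact (MeasurableSet.const _).nullMeasurableSet
    | succ n ih =>
      intro F
      have : {x | (step stat sel C x)^[n + 1] ∅ = F} = ⋃ E : Finset (Fin M),
          {x | (step stat sel C x)^[n] ∅ = E} ∩ {x | step stat sel C x E = F} := by
        ext x
        simp [Function.iterate_succ_apply']
      rw [this]
      exact NullMeasurableSet.iUnion fun E => (ih E).inter (hstep E F)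
  have hmem : NullMeasurableSet {x | i ∈ rejected stat sel C x} P := by
    have : {x | i ∈ rejected stat sel C x} = ⋃ E : Finset (Fin M),
        {x | (step stat sel C x)^[M] ∅ = E} ∩ {_x | i ∈ E} := by
      ext x
      simp [rejected]
    rw [this]
    exact NullMeasurableSet.iUnion fun E =>
      (hiter M E).inter (MeasurableSet.const _).nullMeasurableSet
  have : individualTest (rejected stat sel C) i
      = {x | i ∈ rejected stat sel C x}.indicator fun _ => (1 : ℝ) := by
    ext x
    simp [individualTest, Set.indicator_apply]
  rw [this]
  exact aemeasurable_const.indicator₀ hmem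

end StepDown

/-! ### Conditional residuals as linear functionals -/

section Residuals

variable {M : ℕ} {S : Matrix (Fin M) (Fin M) ℝ}

lemma subCov_posDef (hS : S.PosDef) (E : Finset (Fin M)) (j : Fin M) : (subCov S E j).PosDef :=
  hS.submatrix Subtype.val_injective

lemma subCov_nonsing (hS : S.PosDef) (E : Finset (Fin M)) (j : Fin M) :
    IsUnit (subCov S E j).det :=
  (subCov_posDef hS E j).det_pos.ne'.isUnit

/-- The conditional residual as a linear functional. -/
def residLinear (S : Matrix (Fin M) (Fin M) ℝ) (E : Finset (Fin M)) (j : Fin M) :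
    EuclideanSpace ℝ (Fin M) →ₗ[ℝ] ℝ where
  toFun := resid S E j
  map_add' x y := by
    have : (fun k : {k // k ∈ others E j} => (x + y) k.val) =
        (fun k => x k.val) + fun k => y k.val := rfl
    rw [resid, this, Matrix.mulVec_add, dotProduct_add, PiLp.add_apply, resid, resid]
    ring
  map_smul' r x := by
    have : (fun k : {k // k ∈ others E j} => (r • x) k.val) = r • fun k => x k.val := rfl
    rw [resid, this, Matrix.mulVec_smul, dotProduct_smul, PiLp.smul_apply, smul_eq_mul,
      smul_eq_mul, RingHom.id_apply, smul_eq_mul, resid]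
    ring

@[simp]
lemma residLinear_apply (E : Finset (Fin M)) (j : Fin M) (x : EuclideanSpace ℝ (Fin M)) :
    residLinear S E j x = resid S E j x := rfl

lemma measurable_resid (E : Finset (Fin M)) (j : Fin M) : Measurable (resid S E j) :=
  (residLinear S E j).continuous_of_finiteDimensional.measurable

/-- The `i`-th column of the covariance matrix, as a direction in the sample space. Moving the
data in this direction changes only the `i`-th coordinate of `S⁻¹ x`. -/
def covCol (S : Matrix (Fin M) (Fin M) ℝ) (i : Fin M) : EuclideanSpace ℝ (Fin M) :=
  WithLp.toLp 2 fun k => S k i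

lemma mem_others {E : Finset (Fin M)} {j k : Fin M} : k ∈ others E j ↔ k ≠ j ∧ k ∉ E := by
  simp [others]

lemma resid_covCol_of_mem (hS : S.PosDef) {E : Finset (Fin M)} {i j : Fin M}
    (hi : i ∈ others E j) : resid S E j (covCol S i) = 0 := by
  have h1 : (fun k : {k // k ∈ others E j} => covCol S i k.val)
      = subCov S E j *ᵥ Pi.single ⟨i, hi⟩ 1 := by
    ext k
    simp [covCol, subCov]
  rw [resid, h1, Matrix.mulVec_mulVec, Matrix.nonsing_inv_mul _ (subCov_nonsing hS E j),
    Matrix.one_mulVec]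
  simp [covCol, crossCov]

lemma crossCov_eq (hS : S.PosDef) (E : Finset (Fin M)) (j : Fin M) :
    crossCov S E j = fun k => S k.val j := by
  ext k
  have := hS.isHermitian.apply j k.val
  simpa [crossCov] using this.symm

lemma sum_dite_mem_others (E : Finset (Fin M)) (j : Fin M) (f : Fin M → ℝ)
    (c : {k // k ∈ others E j} → ℝ) :
    ∑ l, f l * (if h : l ∈ others E j then c ⟨l, h⟩ else 0) = ∑ l, f l.val * c l := by
  have h1 := Finset.sum_coe_sort (others E j)
    (fun l => f l * (if h : l ∈ others E j then c ⟨l, h⟩ else 0))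
  rw [← Finset.sum_subset (Finset.subset_univ (others E j)), ← h1]
  · refine Finset.sum_congr rfl fun l _ => ?_
    rw [dif_pos l.2]
  · intro l _ hl
    rw [dif_neg hl, mul_zero]

/-- The conditional variance is the value of the positive definite form at the coefficient vector
`w` of the conditional residual, since `S w` vanishes at the indices in `others E j`. -/
lemma condVar_pos (hS : S.PosDef) {E : Finset (Fin M)} {j : Fin M} : 0 < condVar S E j := by
  -- the coefficients of the conditional residual of the `j`-th variable
  set c := (subCov S E j)⁻¹ *ᵥ crossCov S E j with hc
  set u : Fin M → ℝ := fun l => if h : l ∈ others E j then c ⟨l, h⟩ else 0 with hu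
  set w : Fin M → ℝ := Pi.single j 1 - u with hw
  have hwj : w j = 1 := by simp [hw, hu]
  have hSw : ∀ k, (S *ᵥ w) k = S k j - ∑ l : {l // l ∈ others E j}, S k l.val * c l := by
    intro k
    rw [hw, Matrix.mulVec_sub, Pi.sub_apply, Matrix.mulVec_single_one]
    congr 1
    exact sum_dite_mem_others E j (fun l => S k l) c
  have hsub : subCov S E j *ᵥ c = crossCov S E j := by
    rw [hc, Matrix.mulVec_mulVec, Matrix.mul_nonsing_inv _ (subCov_nonsing hS E j),
      Matrix.one_mulVec]
  have hSwk : ∀ k, k ≠ j → w k * (S *ᵥ w) k = 0 := by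
    intro k hk
    by_cases hko : k ∈ others E j
    · have h1 := congrFun hsub ⟨k, hko⟩
      have h2 := congrFun (crossCov_eq hS E j) ⟨k, hko⟩
      rw [hSw]
      have h3 : ∑ l : {l // l ∈ others E j}, S k l.val * c l = S k j := by
        rw [h2] at h1
        exact h1
      rw [h3, sub_self, mul_zero]
    · have : w k = 0 := by
        rw [hw, Pi.sub_apply, Pi.single_eq_of_ne hk, hu]
        simp only [dif_neg hko, sub_zero]
      rw [this, zero_mul]
  have hform : w ⬝ᵥ (S *ᵥ w) = condVar S E j := by
    rw [dotProduct, Finset.sum_eq_single j (fun k _ hk => hSwk k hk) (by simp), hwj, one_mul, hSw]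
    rfl
  have hw0 : w ≠ 0 := fun h => by
    rw [h] at hwj
    exact zero_ne_one hwj
  have := hS.dotProduct_mulVec_pos hw0
  rw [star_trivial, hform] at this
  exact this

lemma resid_covCol_self (hS : S.PosDef) (E : Finset (Fin M)) (j : Fin M) :
    resid S E j (covCol S j) = √(condVar S E j) := by
  have h1 : (fun k : {k // k ∈ others E j} => covCol S j k.val) = crossCov S E j := by
    rw [crossCov_eq hS]
    rfl
  rw [resid, h1]
  exact Real.div_sqrt

lemma resid_add_smul_covCol (E : Finset (Fin M)) (i j : Fin M) (x : EuclideanSpace ℝ (Fin M))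
    (r : ℝ) : resid S E j (x + r • covCol S i) = resid S E j x + r * resid S E j (covCol S i) := by
  simp only [← residLinear_apply, map_add, map_smul, smul_eq_mul]

/-- Two different competing residuals have almost surely different absolute values: moving the
data along a column of the covariance matrix changes only one of them. -/
lemma ae_noTies_resid (hS : S.PosDef) :
    ∀ᵐ x : EuclideanSpace ℝ (Fin M), NoTies (fun E j x => |resid S E j x|) x := by
  simp only [NoTies]
  rw [ae_all_iff]; intro E
  rw [ae_all_iff]; intro j
  rw [ae_all_iff]; intro k
  by_cases hj : j ∈ E
  · simp [hj]
  by_cases hk : k ∈ E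
  · simp [hk]
  by_cases hjk : j = k
  · simp [hjk]
  have hne : ∀ s : ℝ, residLinear S E j - s • residLinear S E k ≠ 0 := by
    intro s h
    have h1 := LinearMap.congr_fun h (covCol S j)
    have h2 : j ∈ others E k := mem_others.2 ⟨hjk, hj⟩
    simp only [LinearMap.sub_apply, LinearMap.smul_apply, residLinear_apply, LinearMap.zero_apply,
      resid_covCol_of_mem hS h2, resid_covCol_self hS, smul_zero, sub_zero] at h1
    exact (Real.sqrt_pos.2 (condVar_pos hS)).ne' h1
  have hnull : ∀ s : ℝ, ∀ᵐ x : EuclideanSpace ℝ (Fin M),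
      x ∉ (residLinear S E j - s • residLinear S E k).ker := by
    intro s
    refine measure_eq_zero_iff_ae_notMem.1 (Measure.addHaar_submodule _
      (residLinear S E j - s • residLinear S E k).ker fun h => hne s ?_)
    exact LinearMap.ker_eq_top.1 h
  filter_upwards [hnull 1, hnull (-1)] with x h1 h2 _ _ _ heq
  rw [LinearMap.mem_ker, LinearMap.sub_apply, LinearMap.smul_apply, residLinear_apply,
    residLinear_apply, smul_eq_mul] at h1 h2
  rcases abs_eq_abs.1 heq with h | h
  · exact h1 (by rw [h]; ring)
  · exact h2 (by rw [h]; ring)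

end Residuals

/-! ### Normal and chi-square densities -/

section Densities

lemma map_withDensity_equiv {α β : Type*} [MeasurableSpace α] [MeasurableSpace β] (e : α ≃ᵐ β)
    (m : Measure α) (f : α → ENNReal) :
    (m.withDensity f).map e = (m.map e).withDensity fun y => f (e.symm y) := by
  ext s hs
  rw [Measure.map_apply e.measurable hs, withDensity_apply _ (e.measurable hs),
    withDensity_apply _ hs, e.restrict_map, lintegral_map_equiv]
  simp

lemma withDensity_ofReal_const_mul {α : Type*} [MeasurableSpace α] (m : Measure α) {c : ℝ}
    (hc : 0 ≤ c) (f : α → ℝ) :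
    m.withDensity (fun x => ENNReal.ofReal (c * f x))
      = ENNReal.ofReal c • m.withDensity fun x => ENNReal.ofReal (f x) := by
  rw [← withDensity_smul' _ _ ENNReal.ofReal_ne_top]
  congr 1
  ext x
  rw [Pi.smul_apply, smul_eq_mul, ENNReal.ofReal_mul hc]

open scoped RealInnerProductSpace in
/-- The standard normal law has its usual density, up to a constant: the characteristic functions
agree. -/
lemma exists_stdGaussian_eq_withDensity (E : Type*) [NormedAddCommGroup E] [InnerProductSpace ℝ E]
    [FiniteDimensional ℝ E] [MeasurableSpace E] [BorelSpace E] :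
    ∃ c > 0, stdGaussian E
      = volume.withDensity fun x : E => ENNReal.ofReal (c * Real.exp (-‖x‖ ^ 2 / 2)) := by
  set K : ℝ := (Real.pi / (1 / 2)) ^ (Module.finrank ℝ E / 2 : ℝ) with hK
  have hKpos : 0 < K := by positivity
  have hint : ∫ x : E, Real.exp (-‖x‖ ^ 2 / 2) = K := by
    rw [hK, ← GaussianFourier.integral_rexp_neg_mul_sq_norm (V := E)
      (by norm_num : (0 : ℝ) < 1 / 2)]
    congr 1
    ext x
    ring_nf
  have hi : Integrable fun x : E => Real.exp (-‖x‖ ^ 2 / 2) := by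
    by_contra h
    rw [integral_undef h] at hint
    exact hKpos.ne hint
  have hm : Measurable fun x : E => Real.exp (-‖x‖ ^ 2 / 2) := by fun_prop
  refine ⟨K⁻¹, by positivity, ?_⟩
  have hfin : IsFiniteMeasure
      ((volume : Measure E).withDensity fun x => ENNReal.ofReal (K⁻¹ * Real.exp (-‖x‖ ^ 2 / 2))) :=
    isFiniteMeasure_withDensity_ofReal (hi.const_mul _).2
  refine Measure.ext_of_charFun (funext fun t => ?_)
  rw [charFun_stdGaussian, charFun_apply,
    integral_withDensity_eq_integral_toReal_smul (by fun_prop)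
      (ae_of_all _ fun x => ENNReal.ofReal_lt_top)]
  have h1 : ∀ x : E, (ENNReal.ofReal (K⁻¹ * Real.exp (-‖x‖ ^ 2 / 2))).toReal •
      Complex.exp (⟪x, t⟫ * Complex.I)
      = (K⁻¹ : ℂ) * Complex.exp (-(1 / 2 : ℂ) * ‖x‖ ^ 2 + Complex.I * ⟪t, x⟫) := by
    intro x
    rw [ENNReal.toReal_ofReal (by positivity), Complex.real_smul, Complex.exp_add,
      real_inner_comm]
    push_cast
    ring_nf
  simp_rw [h1]
  rw [integral_const_mul, GaussianFourier.integral_cexp_neg_mul_sq_norm_add (by norm_num)]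
  have h2 : ((Real.pi : ℂ) / (1 / 2)) ^ (Module.finrank ℝ E / 2 : ℂ) = (K : ℂ) := by
    rw [hK, Complex.ofReal_cpow (by positivity)]
    push_cast
    rfl
  rw [h2, ← mul_assoc, inv_mul_cancel₀ (by exact_mod_cast hKpos.ne'), one_mul, Complex.I_sq]
  congr 1
  ring

variable {M : ℕ}

/-- The quadratic form of the inverse covariance matrix. -/
def quad (S : Matrix (Fin M) (Fin M) ℝ) (x : EuclideanSpace ℝ (Fin M)) : ℝ :=
  (fun k => x k) ⬝ᵥ (S⁻¹ *ᵥ fun k => x k)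

lemma continuous_quad (S : Matrix (Fin M) (Fin M) ℝ) : Continuous (quad S) := by
  unfold quad
  fun_prop

open scoped MatrixOrder in
/-- A nondegenerate normal law has the familiar density, up to a constant. -/
lemma exists_multivariateGaussian_eq_withDensity {S : Matrix (Fin M) (Fin M) ℝ} (hS : S.PosDef)
    (μ : EuclideanSpace ℝ (Fin M)) :
    ∃ c > 0, multivariateGaussian μ S
      = volume.withDensity fun x => ENNReal.ofReal (c * Real.exp (-quad S (x - μ) / 2)) := by
  obtain ⟨c, hc, hstd⟩ := exists_stdGaussian_eq_withDensity (EuclideanSpace ℝ (Fin M))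
  set R := CFC.sqrt S with hR
  have hRR : R * R = S := CFC.sqrt_mul_sqrt_self S hS.posSemidef.nonneg
  have hRu : IsUnit R.det := by
    have h1 : R.det * R.det = S.det := by rw [← Matrix.det_mul, hRR]
    refine isUnit_iff_ne_zero.2 fun h => hS.det_pos.ne' ?_
    rw [← h1, h, zero_mul]
  have hRs : Rᵀ = R := by
    have := (CFC.sqrt_nonneg S).isSelfAdjoint
    rw [← hR] at this
    simpa [IsSelfAdjoint, Matrix.star_eq_conjTranspose] using this
  set A := Matrix.toEuclideanCLM (n := Fin M) (𝕜 := ℝ) R with hA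
  set B := Matrix.toEuclideanCLM (n := Fin M) (𝕜 := ℝ) R⁻¹ with hB
  have hAB : ∀ x, A (B x) = x := by
    intro x
    have : A * B = 1 := by rw [hA, hB, ← map_mul, Matrix.mul_nonsing_inv _ hRu, map_one]
    exact DFunLike.congr_fun this x
  have hBA : ∀ x, B (A x) = x := by
    intro x
    have : B * A = 1 := by rw [hA, hB, ← map_mul, Matrix.nonsing_inv_mul _ hRu, map_one]
    exact DFunLike.congr_fun this x
  let e : EuclideanSpace ℝ (Fin M) ≃ᵐ EuclideanSpace ℝ (Fin M) :=
    { toFun := fun x => μ + A x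
      invFun := fun x => B (x - μ)
      left_inv := fun x => by simp [hBA]
      right_inv := fun x => by simp [hAB]
      measurable_toFun := A.measurable.const_add μ
      measurable_invFun := B.measurable.comp (measurable_id.sub_const μ) }
  have he : ⇑e = (fun x => μ + x) ∘ A.toLinearMap := rfl
  have hes : ∀ x, e.symm x = B (x - μ) := fun x => rfl
  have hdet : LinearMap.det A.toLinearMap ≠ 0 := by
    have : A.toLinearMap ∘ₗ B.toLinearMap = LinearMap.id := LinearMap.ext hAB
    intro h
    have h2 := congrArg LinearMap.det this
    rw [LinearMap.det_comp, h, zero_mul, LinearMap.det_id] at h2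
    exact zero_ne_one h2
  have hvol : (volume : Measure (EuclideanSpace ℝ (Fin M))).map e
      = ENNReal.ofReal |(LinearMap.det A.toLinearMap)⁻¹| • volume := by
    rw [he, ← Measure.map_map (measurable_const_add μ) (by exact A.measurable),
      Measure.map_linearMap_addHaar_eq_smul_addHaar _ hdet, Measure.map_smul,
      map_add_left_eq_self]
  have hquad : ∀ x, ‖B x‖ ^ 2 = quad S x := by
    intro x
    have h1 : S⁻¹ = R⁻¹ᵀ * R⁻¹ := by
      rw [← hRR, Matrix.mul_inv_rev, Matrix.transpose_nonsing_inv, hRs]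
    rw [EuclideanSpace.real_norm_sq_eq, quad, h1, ← Matrix.mulVec_mulVec,
      Matrix.dotProduct_mulVec, Matrix.vecMul_transpose]
    simp only [dotProduct, sq]
    rfl
  have hmap : multivariateGaussian μ S = (stdGaussian (EuclideanSpace ℝ (Fin M))).map e := rfl
  refine ⟨|(LinearMap.det A.toLinearMap)⁻¹| * c, by positivity, ?_⟩
  rw [hmap, hstd, map_withDensity_equiv, hvol, withDensity_smul_measure]
  simp_rw [mul_assoc]
  rw [withDensity_ofReal_const_mul _ (abs_nonneg _)]
  simp_rw [hes, hquad]

/-- The scaled chi-square density, up to a constant. -/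
lemma exists_map_chiSquare_eq_withDensity {ν v : ℝ} (hν : 0 < ν) (hv : 0 < v) :
    ∃ c > 0, (chiSquare ν).map (fun w => v * w / ν) = volume.withDensity fun s =>
      ENNReal.ofReal (c *
        (if 0 ≤ s then s ^ (ν / 2 - 1) * Real.exp (-(ν * s) / (2 * v)) else 0)) := by
  have hk : v / ν ≠ 0 := by positivity
  set K : ℝ := (1 / 2 : ℝ) ^ (ν / 2) / Real.Gamma (ν / 2) with hK
  have hKpos : 0 < K := div_pos (by positivity) (Real.Gamma_pos_of_pos (by positivity))
  refine ⟨|(v / ν)⁻¹| * (K * (ν / v) ^ (ν / 2 - 1)), by positivity, ?_⟩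
  have h1 : (fun w : ℝ => v * w / ν) = MeasurableEquiv.mulLeft₀ (v / ν) hk := by
    ext w
    simp only [MeasurableEquiv.coe_mulLeft₀]
    ring
  have h2 : (volume : Measure ℝ).map (MeasurableEquiv.mulLeft₀ (v / ν) hk)
      = ENNReal.ofReal |(v / ν)⁻¹| • volume := by
    rw [MeasurableEquiv.coe_mulLeft₀]
    exact Real.map_volume_mul_left hk
  rw [h1, chiSquare, gammaMeasure, map_withDensity_equiv, h2, withDensity_smul_measure]
  simp_rw [mul_assoc]
  rw [withDensity_ofReal_const_mul _ (abs_nonneg _)]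
  congr 2
  ext s
  have h3 : (MeasurableEquiv.mulLeft₀ (v / ν) hk).symm s = ν / v * s := by
    rw [MeasurableEquiv.symm_apply_eq]
    simp only [MeasurableEquiv.coe_mulLeft₀]
    field_simp
  rw [h3, gammaPDF_eq]
  congr 1
  by_cases hs : 0 ≤ s
  · rw [if_pos hs, if_pos (by positivity), Real.mul_rpow (by positivity) hs, ← hK]
    have : -(1 / 2 * (ν / v * s)) = -(ν * s) / (2 * v) := by field_simp
    rw [this]
    ring
  · rw [if_neg hs, if_neg, mul_zero, mul_zero]
    push Not at hs ⊢
    exact mul_neg_of_pos_of_neg (by positivity) hs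

/-- Two densities that differ by a positive factor `w` and a constant. -/
lemma exists_smul_withDensity {α : Type*} [MeasurableSpace α] {m P Q : Measure α} {p p₀ w : α → ℝ}
    {c c₀ k : ℝ} (hc : 0 < c) (hc₀ : 0 < c₀) (hk : 0 < k)
    (hP : P = m.withDensity fun x => ENNReal.ofReal (c * p x))
    (hQ : Q = m.withDensity fun x => ENNReal.ofReal (c₀ * p₀ x)) (hp₀ : Measurable p₀)
    (hw : Measurable w) (hw0 : ∀ x, 0 ≤ w x) (h : ∀ x, p x = k * (p₀ x * w x)) :
    ∃ b : ENNReal, b ≠ 0 ∧ b ≠ ⊤ ∧ P = b • Q.withDensity fun x => ENNReal.ofReal (w x) := by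
  refine ⟨ENNReal.ofReal (c * k / c₀), by simp; positivity, ENNReal.ofReal_ne_top, ?_⟩
  rw [hP, hQ, ← withDensity_mul _ (by fun_prop) (by fun_prop),
    ← withDensity_smul' _ _ ENNReal.ofReal_ne_top]
  congr 1
  ext x
  rw [Pi.smul_apply, smul_eq_mul, Pi.mul_apply, ← ENNReal.ofReal_mul' (hw0 x),
    ← ENNReal.ofReal_mul (by positivity), h]
  congr 1
  field_simp

end Densities

/-! ### Admissibility of step-down procedures with monotone statistics -/

section Procedure

lemma NoTies.of_abs {𝒳 : Type*} {M : ℕ} {U : Finset (Fin M) → Fin M → 𝒳 → ℝ} {x : 𝒳}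
    (h : NoTies (fun E j x => |U E j x|) x) : NoTies U x :=
  fun E j k hj hk hjk heq => h E j k hj hk hjk (congrArg abs heq)

variable {𝒳 Θ V : Type*} [MeasurableSpace 𝒳] [NormedAddCommGroup V] [NormedSpace ℝ V]
  [CompleteSpace V] [SecondCountableTopology V] [MeasurableSpace V] [BorelSpace V]
  {M : ℕ} {P : Θ → Measure 𝒳} {P₀ : Measure 𝒳}

/-- Suppose that, when the nuisance statistics of the `i`-th problem are fixed, the statistics of
the other hypotheses are constant and those of the `i`-th one increase with `Z i`. Then the
step-down procedures based on `|U|` and on `U` are admissible. -/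
theorem stepDownAdmissible_of_monotone {T : Fin M → 𝒳 → V} {Z : Fin M → 𝒳 → ℝ}
    {q : Fin M → Θ → ℝ} (hP : ∀ i, IsLocalExpFamily P P₀ (T i) (Z i) (q i))
    {U : Finset (Fin M) → Fin M → 𝒳 → ℝ} (C : Fin M → ℝ) (hU : ∀ E j, Measurable (U E j))
    (hties : ∀ᵐ x ∂P₀, NoTies (fun E j x => |U E j x|) x)
    (hother : ∀ i x x', T i x = T i x' → ∀ E j, i ∉ E → j ≠ i → U E j x = U E j x')
    (hmono : ∀ i x x', T i x = T i x' → Z i x ≤ Z i x' → ∀ E, U E i x ≤ U E i x') :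
    StepDownAdmissible P (fun i => {θ | q i θ = 0}) (fun i => {θ | q i θ ≠ 0})
      (fun E j x => |U E j x|) C ∧
    StepDownAdmissible P (fun i => {θ | q i θ = 0}) (fun i => {θ | 0 < q i θ}) U C ∧
    StepDownAdmissible P (fun i => {θ | q i θ ≤ 0}) (fun i => {θ | 0 < q i θ}) U C := by
  have htest : ∀ {stat : Finset (Fin M) → Fin M → 𝒳 → ℝ} {sel : 𝒳 → Finset (Fin M) → Fin M},
      IsMaximizer stat sel → (∀ E j, Measurable (stat E j)) → (∀ᵐ x ∂P₀, NoTies stat x) →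
      ∀ i, IsTest P (individualTest (rejected stat sel C) i) := by
    intro stat sel hsel hm hn i
    refine ⟨fun θ => aemeasurable_individualTest hsel hm (((hP i).ac θ).ae_le hn) i, fun x => ?_⟩
    rcases individualTest_eq_zero_or_one (rejected stat sel C) i x with h | h <;> simp [h]
  have hlower : ∀ (H : Fin M → Set Θ), (∀ i θ, q i θ = 0 → θ ∈ H i) →
      StepDownAdmissible P H (fun i => {θ | 0 < q i θ}) U C := by
    intro H hH sel hsel i
    have hn : ∀ᵐ x ∂P₀, NoTies U x := hties.mono fun x hx => hx.of_abs
    refine (hP i).isAdmissibleTest_of_isLowerSet (htest hsel hU hn i)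
      (individualTest_eq_zero_or_one _ i) (G := {x | NoTies U x}) hn ?_ (hH i)
    intro x₂ h2 x₃ h3 hT hZ h30
    rw [individualTest_eq_zero_iff] at h30 ⊢
    refine notMem_rejected_of_sections hsel h3 h2 h3
      (fun E j hi _ hj => hother i _ _ hT E j hi hj)
      (fun E j hi _ hj => hother i _ _ hT E j hi hj) (fun E _ => ?_) h30 h30
    rw [max_self]
    exact hmono i _ _ hT.symm hZ E
  refine ⟨?_, hlower _ fun i θ h => h, hlower _ fun i θ h => h.le⟩
  intro sel hsel i
  refine (hP i).isAdmissibleTest_of_ordConnected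
    (htest hsel (fun E j => (hU E j).abs) hties i) (individualTest_eq_zero_or_one _ i)
    (G := {x | NoTies (fun E j x => |U E j x|) x}) hties ?_
  intro x₁ h1 x₂ h2 x₃ h3 hT1 hT3 hZ1 hZ3 h10 h30
  rw [individualTest_eq_zero_iff] at h10 h30 ⊢
  exact notMem_rejected_of_sections hsel h1 h2 h3
    (fun E j hi _ hj => congrArg abs (hother i _ _ hT1 E j hi hj))
    (fun E j hi _ hj => congrArg abs (hother i _ _ hT3 E j hi hj))
    (fun E _ => abs_le_max_abs_abs (hmono i _ _ hT1 hZ1 E) (hmono i _ _ hT3.symm hZ3 E)) h10 h30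

end Procedure

/-! ### The natural statistics of the normal models -/

section NormalModels

variable {M : ℕ} {S : Matrix (Fin M) (Fin M) ℝ}

/-- The natural statistic `S⁻¹ x` of the normal model, whose natural parameter is the mean. -/
def natStat (S : Matrix (Fin M) (Fin M) ℝ) (x : EuclideanSpace ℝ (Fin M)) : Fin M → ℝ :=
  S⁻¹ *ᵥ fun k => x k

/-- The natural statistic with its `i`-th coordinate, which belongs to the parameter of interest,
replaced by zero. -/
def nuisStat (S : Matrix (Fin M) (Fin M) ℝ) (i : Fin M) (x : EuclideanSpace ℝ (Fin M)) :
    Fin M → ℝ :=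
  Function.update (natStat S x) i 0

/-- The data, as a function of the nuisance part and the `i`-th coordinate of the natural
statistic. -/
def dataOfStat (S : Matrix (Fin M) (Fin M) ℝ) (i : Fin M) (p : (Fin M → ℝ) × ℝ) :
    EuclideanSpace ℝ (Fin M) :=
  WithLp.toLp 2 (S *ᵥ Function.update p.1 i p.2)

lemma continuous_natStat : Continuous (natStat S) := by
  unfold natStat
  fun_prop

lemma measurable_natStat_apply (i : Fin M) : Measurable fun x => natStat S x i :=
  ((continuous_apply i).comp continuous_natStat).measurable

lemma measurable_nuisStat (i : Fin M) : Measurable (nuisStat S i) :=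
  (continuous_natStat.update i continuous_const).measurable

lemma measurable_dataOfStat (i : Fin M) : Measurable (dataOfStat S i) := by
  have h : Continuous fun p : (Fin M → ℝ) × ℝ => S *ᵥ Function.update p.1 i p.2 :=
    continuous_const.matrix_mulVec (continuous_fst.update i continuous_snd)
  exact ((PiLp.continuous_toLp 2 _).comp h).measurable

lemma dataOfStat_nuisStat (hS : S.PosDef) (i : Fin M) (x : EuclideanSpace ℝ (Fin M)) :
    dataOfStat S i (nuisStat S i x, natStat S x i) = x := by
  rw [dataOfStat, nuisStat, Function.update_idem, Function.update_eq_self, natStat,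
    Matrix.mulVec_mulVec, Matrix.mul_nonsing_inv _ hS.det_pos.ne'.isUnit, Matrix.one_mulVec]

/-- Data with the same nuisance statistic lie on a line in the direction of a column of `S`. -/
lemma eq_add_smul_covCol (hS : S.PosDef) {i : Fin M} {x x' : EuclideanSpace ℝ (Fin M)}
    (h : nuisStat S i x = nuisStat S i x') :
    x' = x + (natStat S x' i - natStat S x i) • covCol S i := by
  have h1 : natStat S x' = natStat S x + Pi.single i (natStat S x' i - natStat S x i) := by
    ext k
    by_cases hk : k = i
    · subst hk; simp
    · have := congrFun h k
      simp only [nuisStat, Function.update_of_ne hk] at this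
      simp [hk, this]
  have h2 : ∀ y : EuclideanSpace ℝ (Fin M), S *ᵥ natStat S y = fun k => y k := by
    intro y
    rw [natStat, Matrix.mulVec_mulVec, Matrix.mul_nonsing_inv _ hS.det_pos.ne'.isUnit,
      Matrix.one_mulVec]
  have h3 := congrArg (fun y => S *ᵥ y) h1
  simp only [Matrix.mulVec_add, h2] at h3
  ext k
  have h4 := congrFun h3 k
  simp only [Pi.add_apply, Matrix.mulVec_single] at h4
  rw [h4]
  simp [covCol, mul_comm]

lemma resid_eq_of_nuisStat_eq (hS : S.PosDef) {i j : Fin M} {x x' : EuclideanSpace ℝ (Fin M)}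
    (h : nuisStat S i x = nuisStat S i x') {E : Finset (Fin M)} (hi : i ∉ E) (hj : j ≠ i) :
    resid S E j x = resid S E j x' := by
  rw [eq_add_smul_covCol hS h, resid_add_smul_covCol,
    resid_covCol_of_mem hS (mem_others.2 ⟨hj.symm, hi⟩), mul_zero, add_zero]

lemma resid_le_of_nuisStat_eq (hS : S.PosDef) {i : Fin M} {x x' : EuclideanSpace ℝ (Fin M)}
    (h : nuisStat S i x = nuisStat S i x') (hle : natStat S x i ≤ natStat S x' i)
    (E : Finset (Fin M)) : resid S E i x ≤ resid S E i x' := by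
  rw [eq_add_smul_covCol hS h, resid_add_smul_covCol, resid_covCol_self hS]
  have := mul_nonneg (sub_nonneg.2 hle) (Real.sqrt_nonneg (condVar S E i))
  linarith

/-- The exponent `μ · S⁻¹ x`, split into its nuisance part and the part of interest. -/
lemma update_dotProduct (L : StrongDual ℝ (Fin M → ℝ)) (i : Fin M) (a : ℝ) (y : Fin M → ℝ) :
    Function.update (fun j => L (Pi.single j 1)) i a ⬝ᵥ y
      = L (Function.update y i 0) + a * y i := by
  have hL : ∀ u : Fin M → ℝ, L u = ∑ j, u j * L (Pi.single j 1) := by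
    intro u
    have := L.toLinearMap.pi_apply_eq_sum_univ u
    simp only [smul_eq_mul] at this
    rw [ContinuousLinearMap.coe_coe] at this
    rw [this]
    refine Finset.sum_congr rfl fun j _ => ?_
    congr 2
    ext k
    simp [Pi.single_apply, eq_comm]
  rw [hL, dotProduct, ← Finset.add_sum_erase _ _ (Finset.mem_univ i),
    ← Finset.add_sum_erase Finset.univ (fun j => Function.update y i 0 j * L (Pi.single j 1))
      (Finset.mem_univ i), Function.update_self, Function.update_self, zero_mul, zero_add, add_comm]
  congr 1
  refine Finset.sum_congr rfl fun j hj => ?_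
  rw [Function.update_of_ne (Finset.ne_of_mem_erase hj),
    Function.update_of_ne (Finset.ne_of_mem_erase hj), mul_comm]

lemma quad_sub (hS : S.PosDef) (x μ : EuclideanSpace ℝ (Fin M)) :
    quad S (x - μ) = quad S x - 2 * ((fun k => μ k) ⬝ᵥ natStat S x) + quad S μ := by
  have h1 : (fun k => (x - μ) k) = (fun k => x k) - fun k => μ k := rfl
  have h2 : (fun k => x k) ⬝ᵥ (S⁻¹ *ᵥ fun k => μ k) = (fun k => μ k) ⬝ᵥ (S⁻¹ *ᵥ fun k => x k) := by
    have hT : S⁻¹ᵀ = S⁻¹ := by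
      have := hS.isHermitian.inv
      simpa [Matrix.IsHermitian] using this
    rw [Matrix.dotProduct_mulVec, ← Matrix.mulVec_transpose, hT, dotProduct_comm]
  rw [quad, h1, Matrix.mulVec_sub, sub_dotProduct, dotProduct_sub, dotProduct_sub, h2, quad, quad,
    natStat]
  ring

lemma quad_smul {v : ℝ} (hv : 0 < v) (hS : S.PosDef) (x : EuclideanSpace ℝ (Fin M)) :
    quad (v • S) x = quad S x / v := by
  have h : (v • S)⁻¹ = v⁻¹ • S⁻¹ := by
    have := Matrix.inv_smul' S (Units.mk0 v hv.ne') hS.det_pos.ne'.isUnit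
    simpa [Units.smul_def] using this
  rw [quad, h, Matrix.smul_mulVec, dotProduct_smul, quad, smul_eq_mul]
  ring

lemma quad_nonneg (hS : S.PosDef) (x : EuclideanSpace ℝ (Fin M)) : 0 ≤ quad S x := by
  have := hS.inv.posSemidef.dotProduct_mulVec_nonneg (fun k => x k)
  simpa [quad] using this

lemma statT_eq (ν : ℝ) (z : EuclideanSpace ℝ (Fin M) × ℝ) :
    statT S ν z = ν * z.2 + quad S z.1 := rfl

lemma measurable_statT (ν : ℝ) : Measurable (statT S ν) := by
  have : statT S ν = fun z => ν * z.2 + quad S z.1 := rfl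
  rw [this]
  exact (measurable_snd.const_mul ν).add ((continuous_quad S).measurable.comp measurable_fst)

/-! ### The normal models as exponential families -/

/-- Every member of the model with known covariance matrix is an exponential tilt of the centered
one. -/
lemma exists_knownModel_eq_tilt (hS : S.PosDef) (μ : EuclideanSpace ℝ (Fin M)) :
    ∃ b : ENNReal, b ≠ 0 ∧ b ≠ ⊤ ∧ knownModel S μ = b • (knownModel S 0).withDensity
      fun x => ENNReal.ofReal (Real.exp ((fun k => μ k) ⬝ᵥ natStat S x)) := by
  obtain ⟨c, hc, h⟩ := exists_multivariateGaussian_eq_withDensity hS μ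
  obtain ⟨c₀, hc₀, h₀⟩ := exists_multivariateGaussian_eq_withDensity hS 0
  have hq := (continuous_quad S).measurable
  have hn : Measurable fun x => (fun k => μ k) ⬝ᵥ natStat S x :=
    (continuous_const.dotProduct continuous_natStat).measurable
  refine exists_smul_withDensity (k := Real.exp (-quad S μ / 2)) hc hc₀ (Real.exp_pos _) h h₀
    ?_ hn.exp (fun x => (Real.exp_pos _).le) fun x => ?_
  · simp only [sub_zero]
    fun_prop
  · rw [← Real.exp_add, ← Real.exp_add, quad_sub hS, sub_zero]
    congr 1
    ring

/-- Every member of the model with unknown variance factor is an exponential tilt of the centered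
one with `σ² = 1`; the natural parameters are `μ / σ²` and `1 / 2 - 1 / (2 σ²)`. -/
lemma exists_unknownModel_eq_tilt (hS : S.PosDef) {ν : ℝ} (hν : 0 < ν)
    (μ : EuclideanSpace ℝ (Fin M)) (v : Set.Ioi (0 : ℝ)) :
    ∃ b : ENNReal, b ≠ 0 ∧ b ≠ ⊤ ∧ unknownModel S ν (μ, v) =
      b • (unknownModel S ν (0, ⟨1, Set.mem_Ioi.2 one_pos⟩)).withDensity fun z =>
        ENNReal.ofReal (Real.exp ((v : ℝ)⁻¹ * ((fun k => μ k) ⬝ᵥ natStat S z.1)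
          + (1 / 2 - 1 / (2 * (v : ℝ))) * statT S ν z)) := by
  have key : ∀ (μ : EuclideanSpace ℝ (Fin M)) (v : Set.Ioi (0 : ℝ)), ∃ c > 0,
      unknownModel S ν (μ, v) = volume.withDensity fun z => ENNReal.ofReal
        (c * (if 0 ≤ z.2 then z.2 ^ (ν / 2 - 1) *
          Real.exp (-(quad S (z.1 - μ) + ν * z.2) / (2 * (v : ℝ))) else 0)) := by
    intro μ v
    have hv : 0 < (v : ℝ) := v.2
    obtain ⟨c₁, hc₁, h₁⟩ := exists_multivariateGaussian_eq_withDensity (hS.smul hv) μ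
    obtain ⟨c₂, hc₂, h₂⟩ := exists_map_chiSquare_eq_withDensity hν hv
    refine ⟨c₁ * c₂, by positivity, ?_⟩
    have hq := (continuous_quad ((v : ℝ) • S)).measurable
    have hm : Measurable fun s : ℝ => ENNReal.ofReal
        (c₂ * (if 0 ≤ s then s ^ (ν / 2 - 1) * Real.exp (-(ν * s) / (2 * (v : ℝ))) else 0)) := by
      refine (Measurable.const_mul ?_ c₂).ennreal_ofReal
      exact Measurable.ite measurableSet_Ici (by fun_prop) measurable_const
    rw [unknownModel, h₁, h₂, prod_withDensity (by fun_prop) hm]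
    change (volume : Measure (EuclideanSpace ℝ (Fin M) × ℝ)).withDensity _ = _
    congr 1
    ext z
    rw [← ENNReal.ofReal_mul (by positivity)]
    congr 1
    split_ifs
    · rw [quad_smul hv hS]
      have : Real.exp (-(quad S (z.1 - μ) + ν * z.2) / (2 * (v : ℝ)))
          = Real.exp (-(quad S (z.1 - μ) / v) / 2) * Real.exp (-(ν * z.2) / (2 * (v : ℝ))) := by
        rw [← Real.exp_add]
        congr 1
        field_simp
        ring
      rw [this]
      ring
    · simp
  obtain ⟨c, hc, h⟩ := key μ v
  obtain ⟨c₀, hc₀, h₀⟩ := key 0 ⟨1, Set.mem_Ioi.2 one_pos⟩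
  have hq := (continuous_quad S).measurable
  have hn : Measurable fun z : EuclideanSpace ℝ (Fin M) × ℝ =>
      (fun k => μ k) ⬝ᵥ natStat S z.1 :=
    (continuous_const.dotProduct (continuous_natStat.comp continuous_fst)).measurable
  have hv : 0 < (v : ℝ) := v.2
  refine exists_smul_withDensity (k := Real.exp (-quad S μ / (2 * (v : ℝ)))) hc hc₀
    (Real.exp_pos _) h h₀ ?_ ?_ (fun x => (Real.exp_pos _).le) fun z => ?_
  · refine Measurable.ite (measurableSet_le measurable_const measurable_snd) ?_ measurable_const
    fun_prop
  · exact ((hn.const_mul _).add ((measurable_statT ν).const_mul _)).exp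
  · split_ifs
    · have : Real.exp (-(quad S (z.1 - μ) + ν * z.2) / (2 * (v : ℝ)))
          = Real.exp (-quad S μ / (2 * (v : ℝ))) *
            (Real.exp (-(quad S (z.1 - 0) + ν * z.2) / (2 * (1 : ℝ))) *
            Real.exp ((v : ℝ)⁻¹ * ((fun k => μ k) ⬝ᵥ natStat S z.1)
              + (1 / 2 - 1 / (2 * (v : ℝ))) * statT S ν z)) := by
        rw [← Real.exp_add, ← Real.exp_add, quad_sub hS, sub_zero, statT_eq]
        congr 1
        field_simp
        ring
      rw [this]
      ring
    · simp

lemma isLocalExpFamily_knownModel (hS : S.PosDef) (i : Fin M) :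
    IsLocalExpFamily (knownModel S) (knownModel S 0) (nuisStat S i) (fun x => natStat S x i)
      (fun μ => μ i) where
  isProb μ := by unfold knownModel; infer_instance
  isFinite := by unfold knownModel; infer_instance
  ac μ := by
    obtain ⟨b, -, -, h⟩ := exists_knownModel_eq_tilt hS μ
    rw [h]
    exact (withDensity_absolutelyContinuous _ _).smul_left b
  measurable_T := measurable_nuisStat i
  measurable_Z := measurable_natStat_apply i
  exists_inverse := ⟨dataOfStat S i, measurable_dataOfStat i, dataOfStat_nuisStat hS i⟩
  exists_tilt := by
    refine ⟨1, one_pos, fun L a _ _ => ?_⟩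
    refine ⟨WithLp.toLp 2 (Function.update (fun j => L (Pi.single j 1)) i a), by simp, ?_⟩
    obtain ⟨b, hb0, hbt, h⟩ := exists_knownModel_eq_tilt hS
      (WithLp.toLp 2 (Function.update (fun j => L (Pi.single j 1)) i a))
    refine ⟨b, hb0, hbt, ?_⟩
    rw [h]
    simp only [update_dotProduct, nuisStat]

lemma isProbabilityMeasure_unknownModel {ν : ℝ} (hν : 0 < ν)
    (θ : EuclideanSpace ℝ (Fin M) × Set.Ioi (0 : ℝ)) :
    IsProbabilityMeasure (unknownModel S ν θ) := by
  have h1 : IsProbabilityMeasure (chiSquare ν) :=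
    isProbabilityMeasure_gammaMeasure (half_pos hν) one_half_pos
  have h2 : IsProbabilityMeasure ((chiSquare ν).map fun w => (θ.2 : ℝ) * w / ν) :=
    Measure.isProbabilityMeasure_map (by fun_prop)
  unfold unknownModel
  infer_instance

lemma isLocalExpFamily_unknownModel (hS : S.PosDef) {ν : ℝ} (hν : 0 < ν) (i : Fin M) :
    IsLocalExpFamily (unknownModel S ν) (unknownModel S ν (0, ⟨1, Set.mem_Ioi.2 one_pos⟩))
      (fun z => (nuisStat S i z.1, statT S ν z)) (fun z => natStat S z.1 i) (fun θ => θ.1 i) where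
  isProb θ := isProbabilityMeasure_unknownModel hν θ
  isFinite := by
    have := isProbabilityMeasure_unknownModel (S := S) hν (0, ⟨1, Set.mem_Ioi.2 one_pos⟩)
    infer_instance
  ac θ := by
    obtain ⟨b, -, -, h⟩ := exists_unknownModel_eq_tilt hS hν θ.1 θ.2
    rw [h]
    exact (withDensity_absolutelyContinuous _ _).smul_left b
  measurable_T := ((measurable_nuisStat i).comp measurable_fst).prodMk (measurable_statT ν)
  measurable_Z := (measurable_natStat_apply i).comp measurable_fst
  exists_inverse := by
    have hd : Measurable fun p : ((Fin M → ℝ) × ℝ) × ℝ => dataOfStat S i (p.1.1, p.2) :=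
      (measurable_dataOfStat i).comp (by fun_prop)
    refine ⟨fun p => (dataOfStat S i (p.1.1, p.2),
      (p.1.2 - quad S (dataOfStat S i (p.1.1, p.2))) / ν), ?_, fun z => ?_⟩
    · have := (continuous_quad S).measurable.comp hd
      exact hd.prodMk ((measurable_fst.snd.sub this).div_const ν)
    · simp only [dataOfStat_nuisStat hS, statT_eq]
      ext1
      · rfl
      · simp only [add_sub_cancel_right]
        exact mul_div_cancel_left₀ _ hν.ne'
  exists_tilt := by
    refine ⟨1 / 2, one_half_pos, fun L a hL _ => ?_⟩
    -- `l` is the coefficient of `T`, which determines `σ²` by `1/2 - 1/(2σ²) = l`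
    set l := L (0, 1) with hl
    set L₁ : StrongDual ℝ (Fin M → ℝ) := L.comp (ContinuousLinearMap.inl ℝ (Fin M → ℝ) ℝ) with hL₁
    have hl2 : l < 1 / 2 := by
      have h1 := L.le_opNorm (0, 1)
      have h2 : ‖((0 : Fin M → ℝ), (1 : ℝ))‖ = 1 := by simp [Prod.norm_def]
      rw [h2, mul_one] at h1
      exact (le_abs_self l).trans_lt (h1.trans_lt hL)
    have hLs : ∀ u t, L (u, t) = L₁ u + l * t := by
      intro u t
      have : ((u, t) : (Fin M → ℝ) × ℝ) = (u, 0) + t • (0, 1) := by simp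
      rw [this, map_add, map_smul, smul_eq_mul, mul_comm]
      rfl
    have hd : 0 < 1 - 2 * l := by linarith
    have hv : 0 < (1 - 2 * l)⁻¹ := inv_pos.2 hd
    set w : Fin M → ℝ := Function.update (fun j => L₁ (Pi.single j 1)) i a with hw
    refine ⟨((1 - 2 * l)⁻¹ • WithLp.toLp 2 w, ⟨(1 - 2 * l)⁻¹, hv⟩), ?_, ?_⟩
    · rw [PiLp.smul_apply, hw, smul_eq_mul, sign_mul, sign_pos hv, one_mul]
      simp
    · obtain ⟨b, hb0, hbt, h⟩ := exists_unknownModel_eq_tilt hS hν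
        ((1 - 2 * l)⁻¹ • WithLp.toLp 2 w) ⟨(1 - 2 * l)⁻¹, hv⟩
      refine ⟨b, hb0, hbt, ?_⟩
      rw [h]
      congr 3
      ext z
      have h1 : (fun k => ((1 - 2 * l)⁻¹ • WithLp.toLp 2 w : EuclideanSpace ℝ (Fin M)) k)
          = (1 - 2 * l)⁻¹ • w := rfl
      rw [h1, smul_dotProduct, hw, update_dotProduct, hLs, nuisStat]
      congr 2
      simp only [smul_eq_mul]
      field_simp
      ring

lemma ae_noTies_knownModel (hS : S.PosDef) :
    ∀ᵐ x ∂(knownModel S 0), NoTies (fun E j x => |resid S E j x|) x := by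
  obtain ⟨c, -, h⟩ := exists_multivariateGaussian_eq_withDensity hS 0
  rw [knownModel, h]
  exact (withDensity_absolutelyContinuous _ _).ae_le (ae_noTies_resid hS)

lemma ae_noTies_unknownModel (hS : S.PosDef) {ν : ℝ} (hν : 0 < ν) :
    ∀ᵐ z ∂(unknownModel S ν (0, ⟨1, Set.mem_Ioi.2 one_pos⟩)),
      NoTies (fun E j z => |residT S ν E j z|) z := by
  have hx : ∀ᵐ x ∂(multivariateGaussian 0 ((1 : ℝ) • S)),
      NoTies (fun E j x => |resid S E j x|) x := by
    rw [one_smul]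
    exact ae_noTies_knownModel hS
  obtain ⟨c, hc, h⟩ := exists_map_chiSquare_eq_withDensity hν (one_pos (α := ℝ))
  have hs : ∀ᵐ s ∂((chiSquare ν).map fun w => (1 : ℝ) * w / ν), 0 < s := by
    rw [h, ae_withDensity_iff]
    · filter_upwards [compl_mem_ae_iff.2 (measure_singleton (0 : ℝ))] with s hs0 hs
      have hs0' : s ≠ 0 := hs0
      by_contra hcon
      refine hs ?_
      rw [if_neg (fun h0 => hcon (lt_of_le_of_ne h0 hs0'.symm)), mul_zero, ENNReal.ofReal_zero]
    · refine (Measurable.const_mul ?_ c).ennreal_ofReal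
      exact Measurable.ite measurableSet_Ici (by fun_prop) measurable_const
  have : IsProbabilityMeasure ((chiSquare ν).map fun w => (1 : ℝ) * w / ν) := by
    have h1 : IsProbabilityMeasure (chiSquare ν) :=
      isProbabilityMeasure_gammaMeasure (half_pos hν) one_half_pos
    exact Measure.isProbabilityMeasure_map (by fun_prop)
  have h1 := (Measure.quasiMeasurePreserving_fst
    (μ := multivariateGaussian 0 ((1 : ℝ) • S))
    (ν := (chiSquare ν).map fun w => (1 : ℝ) * w / ν)).ae hx
  have h2 := (Measure.quasiMeasurePreserving_snd
    (μ := multivariateGaussian 0 ((1 : ℝ) • S))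
    (ν := (chiSquare ν).map fun w => (1 : ℝ) * w / ν)).ae hs
  change ∀ᵐ z ∂((multivariateGaussian 0 ((1 : ℝ) • S)).prod
    ((chiSquare ν).map fun w => (1 : ℝ) * w / ν)), _
  filter_upwards [h1, h2] with z hz1 hz2 E j k hj hk hjk heq
  refine hz1 E j k hj hk hjk ?_
  have hT : 0 < √(statT S ν z) := by
    rw [Real.sqrt_pos, statT_eq]
    have := quad_nonneg hS z.1
    have := mul_pos hν hz2
    linarith
  simp only [residT, abs_div, abs_of_pos hT] at heq
  exact (div_left_inj' hT.ne').1 heq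

end NormalModels

end MRD

end

theorem theorem3p1 {M : ℕ} (S : Matrix (Fin M) (Fin M) ℝ) (hS : S.PosDef)
    (C : Fin M → ℝ) (hC : StrictAnti C) (hCpos : ∀ m, 0 < C m) :
    -- known covariance matrix: `H_i : μ_i = 0` against `K_i : μ_i ≠ 0`
    MRD.StepDownAdmissible (MRD.knownModel S)
      (fun i => {μ | μ i = 0}) (fun i => {μ | μ i ≠ 0})
      (fun E j x => |MRD.resid S E j x|) C ∧
    -- one-sided: `H_i : μ_i = 0` against `K_i : μ_i > 0`
    MRD.StepDownAdmissible (MRD.knownModel S)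
      (fun i => {μ | μ i = 0}) (fun i => {μ | 0 < μ i})
      (fun E j x => MRD.resid S E j x) C ∧
    -- one-sided: `H_i : μ_i ≤ 0` against `K_i : μ_i > 0`
    MRD.StepDownAdmissible (MRD.knownModel S)
      (fun i => {μ | μ i ≤ 0}) (fun i => {μ | 0 < μ i})
      (fun E j x => MRD.resid S E j x) C ∧
    -- covariance matrix `σ² S` with unknown `σ²`: the same three problems
    ∀ ν : ℝ, 0 < ν →
      MRD.StepDownAdmissible (MRD.unknownModel S ν)
        (fun i => {θ | θ.1 i = 0}) (fun i => {θ | θ.1 i ≠ 0})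
        (fun E j z => |MRD.residT S ν E j z|) C ∧
      MRD.StepDownAdmissible (MRD.unknownModel S ν)
        (fun i => {θ | θ.1 i = 0}) (fun i => {θ | 0 < θ.1 i})
        (fun E j z => MRD.residT S ν E j z) C ∧
      MRD.StepDownAdmissible (MRD.unknownModel S ν)
        (fun i => {θ | θ.1 i ≤ 0}) (fun i => {θ | 0 < θ.1 i})
        (fun E j z => MRD.residT S ν E j z) C := by

  obtain ⟨k1, k2, k3⟩ := MRD.stepDownAdmissible_of_monotone
    (fun i => MRD.isLocalExpFamily_knownModel hS i) (U := fun E j x => MRD.resid S E j x) C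
    (fun E j => MRD.measurable_resid E j) (MRD.ae_noTies_knownModel hS)
    (fun i x x' h E j hi hj => MRD.resid_eq_of_nuisStat_eq hS h hi hj)
    (fun i x x' h hle E => MRD.resid_le_of_nuisStat_eq hS h hle E)
  refine ⟨k1, k2, k3, fun ν hν => ?_⟩
  exact MRD.stepDownAdmissible_of_monotone
    (fun i => MRD.isLocalExpFamily_unknownModel hS hν i)
    (U := fun E j z => MRD.residT S ν E j z) C
    (fun E j => ((MRD.measurable_resid E j).comp measurable_fst).div
      (MRD.measurable_statT ν).sqrt) (MRD.ae_noTies_unknownModel hS hν)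
    (fun i z z' h E j hi hj => by
      obtain ⟨h1, h2⟩ := Prod.mk.inj h
      rw [MRD.residT, MRD.residT, h2, MRD.resid_eq_of_nuisStat_eq hS h1 hi hj])
    (fun i z z' h hle E => by
      obtain ⟨h1, h2⟩ := Prod.mk.inj h
      rw [MRD.residT, MRD.residT, h2]
      exact div_le_div_of_nonneg_right (MRD.resid_le_of_nuisStat_eq hS h1 hle E)
        (Real.sqrt_nonneg _))
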